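/- \textbf{Conventions.} Write $\partial=\partial/\partial z$, $\bar\partial=\partial/\partial\bar z$. Let $\Omega\subset\mathbb C$ be open and let $r=(x^1,\dots,x^4):\Omega\to\mathbb R^4$ be a smooth immersion for which $z$ is a conformal parameter, i.e. $\sum_{k=1}^4(\partial x^k)^2=0$. A \emph{Weierstrass representation} of $r$ over $\Omega$ is a tuple of smooth functions $\psi_1,\psi_2,\varphi_1,\varphi_2,U:\Omega\to\mathbb C$ satisfying the Dirac equations $$\partial\psi_2+U\psi_1=0,\quad -\bar\partial\psi_1+\bar U\psi_2=0,\qquad \partial\varphi_2+\bar U\varphi_1=0,\quad -\bar\partial\varphi_1+U\varphi_2=0,$$ and $dx^k=f_k\,dz+\bar f_k\,d\bar z$ on $\Omega$ for $k=1,\dots,4$, where $$f_1=\tfrac i2(\bar\varphi_2\bar\psi_2+\varphi_1\psi_1),\quad f_2=\tfrac12(\bar\varphi_2\bar\psi_2-\varphi_1\psi_1),\quad f_3=\tfrac12(\bar\varphi_2\psi_1+\varphi_1\bar\psi_2),\quad f_4=\tfrac i2(\bar\varphi_2\psi_1-\varphi_1\bar\psi_2).$$ The gauge transformation determined by a function $h$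 is $$(\psi_1,\psi_2,\varphi_1,\varphi_2,U)\mapsto(e^{h}\psi_1,\,e^{\bar h}\psi_2,\,e^{-h}\varphi_1,\,e^{-\bar h}\varphi_2,\,e^{\bar h-h}U).$$ \textbf{Corollary (non-continuable representations).} Let $W\subset\mathbb C$ be open, let $r:W\to\mathbb R^4$ be a smooth immersion for which $z$ is a conformal parameter, and let $V\subsetneq W$ be a non-empty connected open subset which is not a connected component of $W$ (this last condition is automatic when $W$ is connected). Then $r|_V$ has a Weierstrass representation over $V$ that is not the restriction to $V$ of any Weierstrass representation of $r$ over $W$. More precisely, $r$ has a Weierstrass representation over $W$, and there is a holomorphic function $h:V\to\mathbb C$ which is not the restriction to $V$ of a holomorphic function on $W$, such that for every Weierstrass representation of $r$ over $W$, the gauge transformation determined by $h$ of its restriction to $V$ is a Weierstrass representation of $r|_V$ over $V$ that does not extend to a Weierstrass representation of $r$ over $W$. -/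

import Mathlib

open scoped ContDiff ComplexConjugate

noncomputable section

/-- The operator `∂ = ∂/∂z = (∂/∂x - i ∂/∂y) / 2`. -/
def wirtingerD (f : ℂ → ℂ) (z : ℂ) : ℂ :=
  (fderiv ℝ f z 1 - Complex.I * fderiv ℝ f z Complex.I) / 2

/-- The operator `∂̄ = ∂/∂z̄ = (∂/∂x + i ∂/∂y) / 2`. -/
def wirtingerDbar (f : ℂ → ℂ) (z : ℂ) : ℂ :=
  (fderiv ℝ f z 1 + Complex.I * fderiv ℝ f z Complex.I) / 2

/-- `r` restricts on the open set `W` to a smooth immersed surface in Euclidean four-space for which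
`z` is a conformal parameter: the conformality condition is `∑ k, (∂xᵏ/∂z)² = 0`. -/
structure IsConformalImmersionOn (r : ℂ → EuclideanSpace ℝ (Fin 4)) (W : Set ℂ) : Prop where
  smooth : ContDiffOn ℝ ∞ r W
  immersion : ∀ z ∈ W, Function.Injective (fderiv ℝ r z)
  conformal : ∀ z ∈ W, ∑ k : Fin 4, wirtingerD (fun w => ((r w k : ℝ) : ℂ)) z ^ 2 = 0

/-- The data of a Weierstrass representation: two spinors `ψ = (ψ₁, ψ₂)`, `φ = (φ₁, φ₂)` and a
potential `U`. Only the values on the domain under consideration matter. -/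
structure WeierstrassData where
  ψ₁ : ℂ → ℂ
  ψ₂ : ℂ → ℂ
  φ₁ : ℂ → ℂ
  φ₂ : ℂ → ℂ
  U : ℂ → ℂ

namespace WeierstrassData

/-- All components of the data are smooth on `W`. -/
structure SmoothOn (R : WeierstrassData) (W : Set ℂ) : Prop where
  ψ₁ : ContDiffOn ℝ ∞ R.ψ₁ W
  ψ₂ : ContDiffOn ℝ ∞ R.ψ₂ W
  φ₁ : ContDiffOn ℝ ∞ R.φ₁ W
  φ₂ : ContDiffOn ℝ ∞ R.φ₂ W
  U : ContDiffOn ℝ ∞ R.U W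

/-- The Dirac equation `𝒟 ψ = 0` on `W`, where
`𝒟 = [[0, ∂], [-∂̄, 0]] + [[U, 0], [0, Ū]]`. -/
def Dirac (R : WeierstrassData) (W : Set ℂ) : Prop :=
  ∀ z ∈ W, wirtingerD R.ψ₂ z + R.U z * R.ψ₁ z = 0 ∧
    -wirtingerDbar R.ψ₁ z + conj (R.U z) * R.ψ₂ z = 0

/-- The Dirac equation `𝒟^∨ φ = 0` on `W`, where
`𝒟^∨ = [[0, ∂], [-∂̄, 0]] + [[Ū, 0], [0, U]]`. -/
def DualDirac (R : WeierstrassData) (W : Set ℂ) : Prop :=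
  ∀ z ∈ W, wirtingerD R.φ₂ z + conj (R.U z) * R.φ₁ z = 0 ∧
    -wirtingerDbar R.φ₁ z + R.U z * R.φ₂ z = 0

/-- The coefficients `f₁, f₂, f₃, f₄` of the Weierstrass formulas. -/
def coeff (R : WeierstrassData) (z : ℂ) : Fin 4 → ℂ :=
  ![Complex.I / 2 * (conj (R.φ₂ z) * conj (R.ψ₂ z) + R.φ₁ z * R.ψ₁ z),
    1 / 2 * (conj (R.φ₂ z) * conj (R.ψ₂ z) - R.φ₁ z * R.ψ₁ z),
    1 / 2 * (conj (R.φ₂ z) * R.ψ₁ z + R.φ₁ z * conj (R.ψ₂ z)),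
    Complex.I / 2 * (conj (R.φ₂ z) * R.ψ₁ z - R.φ₁ z * conj (R.ψ₂ z))]

/-- The value at the point `z` on the tangent vector `v` of the real one-form
`ηₖ = fₖ dz + f̄ₖ dz̄`. -/
def form (R : WeierstrassData) (k : Fin 4) (z v : ℂ) : ℂ :=
  R.coeff z k * v + conj (R.coeff z k) * conj v

/-- The data `R` is a Weierstrass representation of the surface `r` over `W`: the data is smooth on
`W`, the spinors solve the two Dirac equations with the potential `U`, and the coordinates of
`r` are recovered by integrating the forms `ηₖ`, that is, `dxᵏ = ηₖ` on `W`. -/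
structure Represents (R : WeierstrassData) (r : ℂ → EuclideanSpace ℝ (Fin 4)) (W : Set ℂ) :
    Prop where
  smoothOn : R.SmoothOn W
  dirac : R.Dirac W
  dualDirac : R.DualDirac W
  differential : ∀ z ∈ W, ∀ (k : Fin 4) (v : ℂ),
    ((fderiv ℝ (fun w => r w k) z v : ℝ) : ℂ) = R.form k z v

/-- The gauge transformation of the data determined by `h`. -/
def gauge (h : ℂ → ℂ) (R : WeierstrassData) : WeierstrassData where
  ψ₁ z := Complex.exp (h z) * R.ψ₁ z
  ψ₂ z := Complex.exp (conj (h z)) * R.ψ₂ z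
  φ₁ z := Complex.exp (-h z) * R.φ₁ z
  φ₂ z := Complex.exp (-conj (h z)) * R.φ₂ z
  U z := Complex.exp (conj (h z) - h z) * R.U z

/-- Two data have the same restriction to `V`. -/
structure AgreeOn (R S : WeierstrassData) (V : Set ℂ) : Prop where
  ψ₁ : Set.EqOn R.ψ₁ S.ψ₁ V
  ψ₂ : Set.EqOn R.ψ₂ S.ψ₂ V
  φ₁ : Set.EqOn R.φ₁ S.φ₁ V
  φ₂ : Set.EqOn R.φ₂ S.φ₂ V
  U : Set.EqOn R.U S.U V

/-- The data `S`, given over a subset `V` of `W`, extends to a Weierstrass representation of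
`r` over `W`. -/
def ExtendsTo (S : WeierstrassData) (r : ℂ → EuclideanSpace ℝ (Fin 4)) (V W : Set ℂ) : Prop :=
  ∃ R : WeierstrassData, R.Represents r W ∧ R.AgreeOn S V

end WeierstrassData

/-- The function `h`, given on a subset `V` of `W`, continues analytically to `W`. -/
def ContinuesAnalyticallyTo (h : ℂ → ℂ) (V W : Set ℂ) : Prop :=
  ∃ H : ℂ → ℂ, DifferentiableOn ℂ H W ∧ Set.EqOn H h V

end

/-!
Isotropy of `∂r` says that `∂r` is encoded by a matrix of rank one, `Mᵢⱼ = uᵢ vⱼ`, the two factors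
being the spinors up to conjugation. The lines spanned by the rows of `M` have a smooth nowhere
vanishing generator over an arbitrary open set: the rows are proportional to `(p, q)`, and for a
regular value `t` of `p / q` the function `p - t q` has only isolated simple zeros, which are
divided out by a smooth Weierstrass product. Multiplying the generator `v` by `exp h`, where `h`
solves a `∂̄`-equation, makes `∂̄v` orthogonal to `v`; this is the Dirac equation for `v`. Since
`∂∂̄r` is real, the equation for `u` follows.

For the gauge transformation, take `h = 1 / (z - p)` with `p ∈ W` a boundary point of `V`. The
spinors of an immersion have no common zero, so an extension of the transformed data gives smooth
functions `g₁`, `g₂` near `p` which agree with `exp h` and `exp (-h)` on `V`. Then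
`(z - p)² ∂g₁ = -g₁` on `V`, so `g₁ p = 0` by continuity, contradicting `g₁ g₂ = 1`.
-/

/-! ### Wirtinger calculus -/

section WirtingerCalculus

open Complex Topology

variable {f g : ℂ → ℂ} {z : ℂ} {W : Set ℂ}

theorem fderiv_apply_eq_wirtinger (f : ℂ → ℂ) (z v : ℂ) :
    fderiv ℝ f z v = wirtingerD f z * v + wirtingerDbar f z * conj v := by
  have hfderiv : fderiv ℝ f z v = v.re * fderiv ℝ f z 1 + v.im * fderiv ℝ f z I := by
    rw [← real_smul, ← real_smul, ← map_smul, ← map_smul, ← map_add]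
    simp [re_add_im]
  have hconj : conj v = v.re - v.im * I := Complex.ext (by simp) (by simp)
  rw [hfderiv, wirtingerD, wirtingerDbar, hconj]
  linear_combination (1 / 2 * (fderiv ℝ f z 1 - I * fderiv ℝ f z I)) * re_add_im v
    + ((v.im : ℂ) * fderiv ℝ f z I) * I_mul_I

theorem det_fderiv_eq_wirtinger (f : ℂ → ℂ) (z : ℂ) :
    (fderiv ℝ f z).det = ‖wirtingerD f z‖ ^ 2 - ‖wirtingerDbar f z‖ ^ 2 := by
  rw [ContinuousLinearMap.det, ← LinearMap.det_toMatrix basisOneI, Matrix.det_fin_two]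
  simp only [LinearMap.toMatrix_apply, coe_basisOneI, coe_basisOneI_repr, wirtingerD,
    wirtingerDbar, ← normSq_eq_norm_sq, normSq_div]
  simp [normSq_apply]
  ring

theorem wirtingerDbar_congr (h : f =ᶠ[𝓝 z] g) : wirtingerDbar f z = wirtingerDbar g z := by
  simp only [wirtingerDbar, h.fderiv_eq]

theorem wirtingerDbar_add (hf : DifferentiableAt ℝ f z) (hg : DifferentiableAt ℝ g z) :
    wirtingerDbar (fun w => f w + g w) z = wirtingerDbar f z + wirtingerDbar g z := by
  simp only [wirtingerDbar, fderiv_fun_add hf hg, add_apply]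
  ring

theorem wirtingerDbar_const_mul (c : ℂ) (hf : DifferentiableAt ℝ f z) :
    wirtingerDbar (fun w => c * f w) z = c * wirtingerDbar f z := by
  simp only [wirtingerDbar, fderiv_const_mul hf, smul_apply, smul_eq_mul]
  ring

theorem wirtingerDbar_sum {ι : Type*} (s : Finset ι) {F : ι → ℂ → ℂ}
    (hF : ∀ i ∈ s, DifferentiableAt ℝ (F i) z) :
    wirtingerDbar (fun w => ∑ i ∈ s, F i w) z = ∑ i ∈ s, wirtingerDbar (F i) z := by
  simp only [wirtingerDbar, fderiv_fun_sum hF, sum_apply, Finset.mul_sum]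
  rw [← Finset.sum_add_distrib, Finset.sum_div]

theorem wirtingerD_mul (hf : DifferentiableAt ℝ f z) (hg : DifferentiableAt ℝ g z) :
    wirtingerD (fun w => f w * g w) z = wirtingerD f z * g z + f z * wirtingerD g z := by
  simp only [wirtingerD, fderiv_fun_mul hf hg, add_apply, smul_apply, smul_eq_mul]
  ring

theorem wirtingerDbar_mul (hf : DifferentiableAt ℝ f z) (hg : DifferentiableAt ℝ g z) :
    wirtingerDbar (fun w => f w * g w) z = wirtingerDbar f z * g z + f z * wirtingerDbar g z := by
  simp only [wirtingerDbar, fderiv_fun_mul hf hg, add_apply, smul_apply, smul_eq_mul]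
  ring

theorem wirtingerD_conj (f : ℂ → ℂ) (z : ℂ) :
    wirtingerD (fun w => conj (f w)) z = conj (wirtingerDbar f z) := by
  have hfderiv (v : ℂ) : fderiv ℝ (fun w => conj (f w)) z v = conj (fderiv ℝ f z v) := by
    simpa using DFunLike.congr_fun (fderiv_star (𝕜 := ℝ) (f := f) (x := z)) v
  simp [wirtingerD, wirtingerDbar, hfderiv, sub_eq_add_neg, map_ofNat]

theorem wirtingerDbar_cexp (hf : DifferentiableAt ℝ f z) :
    wirtingerDbar (fun w => exp (f w)) z = exp (f z) * wirtingerDbar f z := by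
  simp only [wirtingerDbar, hf.hasFDerivAt.cexp.fderiv, smul_apply, smul_eq_mul]
  ring

theorem wirtingerDbar_eq_zero (hf : DifferentiableAt ℂ f z) : wirtingerDbar f z = 0 := by
  have h : fderiv ℝ f z I = I * fderiv ℝ f z 1 := by
    rw [hf.fderiv_restrictScalars ℝ]
    simp
  rw [wirtingerDbar, h]
  linear_combination (fderiv ℝ f z 1) / 2 * I_mul_I

theorem differentiableAt_of_wirtingerDbar_eq_zero (hf : DifferentiableAt ℝ f z)
    (h : wirtingerDbar f z = 0) : DifferentiableAt ℂ f z := by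
  have hlinear : (ContinuousLinearMap.toSpanSingleton ℂ (wirtingerD f z)).restrictScalars ℝ
      = fderiv ℝ f z := by
    ext
    simp [fderiv_apply_eq_wirtinger f, h, mul_comm]
  exact (hasFDerivAt_of_restrictScalars ℝ hf.hasFDerivAt hlinear).differentiableAt

theorem contDiffOn_wirtingerD {m n : WithTop ℕ∞} (hf : ContDiffOn ℝ n f W) (hW : IsOpen W)
    (hmn : m + 1 ≤ n) : ContDiffOn ℝ m (wirtingerD f) W := by
  have h := hf.fderiv_of_isOpen hW hmn
  unfold wirtingerD
  fun_prop

theorem contDiffOn_wirtingerDbar {m n : WithTop ℕ∞} (hf : ContDiffOn ℝ n f W) (hW : IsOpen W)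
    (hmn : m + 1 ≤ n) : ContDiffOn ℝ m (wirtingerDbar f) W := by
  have h := hf.fderiv_of_isOpen hW hmn
  unfold wirtingerDbar
  fun_prop

theorem differentiableAt_of_contDiffOn {E : Type*} [NormedAddCommGroup E] [NormedSpace ℝ E]
    {f : ℂ → E} (hf : ContDiffOn ℝ ∞ f W) (hW : IsOpen W) (hz : z ∈ W) :
    DifferentiableAt ℝ f z :=
  (hf.contDiffAt (hW.mem_nhds hz)).differentiableAt (by simp)

theorem contDiffOn_conj {n : WithTop ℕ∞} (hf : ContDiffOn ℝ n f W) :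
    ContDiffOn ℝ n (fun w => conj (f w)) W :=
  conjCLE.contDiff.comp_contDiffOn hf

theorem contDiffOn_ofReal {n : WithTop ℕ∞} {x : ℂ → ℝ} (hx : ContDiffOn ℝ n x W) :
    ContDiffOn ℝ n (fun w => (x w : ℂ)) W :=
  ofRealCLM.contDiff.comp_contDiffOn hx

theorem wirtingerD_wirtingerDbar_comm (hf : ContDiffAt ℝ 2 f z) :
    wirtingerD (wirtingerDbar f) z = wirtingerDbar (wirtingerD f) z := by
  have hd : DifferentiableAt ℝ (fderiv ℝ f) z :=
    (hf.fderiv_right (m := 1) (by norm_num)).differentiableAt one_ne_zero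
  have happly (v : ℂ) : HasFDerivAt (fun w => fderiv ℝ f w v)
      ((fderiv ℝ (fderiv ℝ f) z).flip v) z := by
    simpa using hd.hasFDerivAt.clm_apply (hasFDerivAt_const v z)
  have hDbar := ((happly 1).add ((happly I).const_mul I)).mul_const (2⁻¹ : ℂ)
  have hD := ((happly 1).sub ((happly I).const_mul I)).mul_const (2⁻¹ : ℂ)
  have hsymm := (hf.isSymmSndFDerivAt (by simp)).eq I 1
  rw [wirtingerD, wirtingerDbar, HasFDerivAt.fderiv (f := wirtingerDbar f) hDbar,
    HasFDerivAt.fderiv (f := wirtingerD f) hD]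
  simp [hsymm]
  ring

theorem wirtingerDbar_ofReal (x : ℂ → ℝ) (z : ℂ) :
    wirtingerDbar (fun w => (x w : ℂ)) z = conj (wirtingerD (fun w => (x w : ℂ)) z) := by
  have h := wirtingerD_conj (fun w => (x w : ℂ)) z
  simp only [conj_ofReal] at h
  rw [h, conj_conj]

theorem ofReal_fderiv_apply_eq_wirtinger {x : ℂ → ℝ} (hx : DifferentiableAt ℝ x z) (v : ℂ) :
    ((fderiv ℝ x z v : ℝ) : ℂ) = wirtingerD (fun w => (x w : ℂ)) z * v
      + conj (wirtingerD (fun w => (x w : ℂ)) z) * conj v := by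
  have hX : HasFDerivAt (fun w => (x w : ℂ)) (ofRealCLM ∘L fderiv ℝ x z) z :=
    ofRealCLM.hasFDerivAt.comp z hx.hasFDerivAt
  rw [← wirtingerDbar_ofReal, ← fderiv_apply_eq_wirtinger, hX.fderiv]
  rfl

theorem conj_wirtingerDbar_wirtingerD_ofReal {x : ℂ → ℝ} (hx : ContDiffAt ℝ 2 x z) :
    conj (wirtingerDbar (wirtingerD fun w => (x w : ℂ)) z)
      = wirtingerDbar (wirtingerD fun w => (x w : ℂ)) z := by
  have hDbarX : wirtingerDbar (fun w => (x w : ℂ))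
      = fun w => conj (wirtingerD (fun w => (x w : ℂ)) w) :=
    funext (wirtingerDbar_ofReal x)
  calc conj (wirtingerDbar (wirtingerD fun w => (x w : ℂ)) z)
      = wirtingerD (fun w => conj (wirtingerD (fun w => (x w : ℂ)) w)) z :=
        (wirtingerD_conj _ z).symm
    _ = wirtingerD (wirtingerDbar fun w => (x w : ℂ)) z := by
        rw [hDbarX]
    _ = wirtingerDbar (wirtingerD fun w => (x w : ℂ)) z :=
        wirtingerD_wirtingerDbar_comm (ofRealCLM.contDiff.contDiffAt.comp z hx)

end WirtingerCalculus

/-! ### The Cauchy transform -/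

section CauchyTransform

open MeasureTheory Set Real

theorem integral_Ioi_fderiv_smul {E F : Type*} [NormedAddCommGroup E] [NormedSpace ℝ E]
    [NormedAddCommGroup F] [NormedSpace ℝ F] [CompleteSpace F] {φ : E → F}
    (hφ : ContDiff ℝ 1 φ) (hc : HasCompactSupport φ) {e : E} (he : e ≠ 0) :
    ∫ r in Ioi (0 : ℝ), fderiv ℝ φ (r • e) e = -φ 0 := by
  have hderiv (r : ℝ) : HasDerivAt (fun r : ℝ => φ (r • e)) (fderiv ℝ φ (r • e) e) r := by
    have hline : HasDerivAt (fun r : ℝ => r • e) e r := by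
      simpa using (hasDerivAt_id r).smul_const e
    exact (hφ.differentiable one_ne_zero _).hasFDerivAt.comp_hasDerivAt r hline
  have hsmooth : ContDiff ℝ 1 fun r : ℝ => φ (r • e) := by fun_prop
  simpa only [(hderiv _).deriv, zero_smul] using HasCompactSupport.integral_Ioi_deriv_eq hsmooth
    (hc.comp_isClosedEmbedding (isClosedEmbedding_smul_left he)) (0 : ℝ)

theorem hasDerivAt_exp_ofReal_mul_I (θ : ℝ) :
    HasDerivAt (fun θ : ℝ => Complex.exp (θ * Complex.I))
      (Complex.I * Complex.exp (θ * Complex.I)) θ := by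
  simpa [mul_comm] using ((hasDerivAt_id (θ : ℂ)).mul_const Complex.I).cexp.comp_ofReal

theorem integral_fderiv_circle {φ : ℂ → ℂ} (hφ : ContDiff ℝ 1 φ) {r : ℝ} (hr : r ≠ 0) :
    ∫ θ in (-π)..π, fderiv ℝ φ (r * Complex.exp (θ * Complex.I))
      (Complex.I * Complex.exp (θ * Complex.I)) = 0 := by
  have hr' : (r : ℂ) ≠ 0 := by exact_mod_cast hr
  have hderiv (θ : ℝ) : HasDerivAt (fun θ : ℝ => (r : ℂ)⁻¹ * φ (r * Complex.exp (θ * Complex.I)))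
      (fderiv ℝ φ (r * Complex.exp (θ * Complex.I))
        (Complex.I * Complex.exp (θ * Complex.I))) θ := by
    have h := ((hφ.differentiable one_ne_zero _).hasFDerivAt.comp_hasDerivAt θ
      ((hasDerivAt_exp_ofReal_mul_I θ).const_mul (r : ℂ))).const_mul (r : ℂ)⁻¹
    rwa [← Complex.real_smul (x := r) (z := Complex.I * _), map_smul, Complex.real_smul,
      inv_mul_cancel_left₀ hr'] at h
  have := hφ.continuous_fderiv one_ne_zero
  rw [intervalIntegral.integral_eq_sub_of_hasDerivAt (fun θ _ => hderiv θ)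
    (Continuous.intervalIntegrable (by fun_prop) _ _)]
  simp [Complex.exp_neg]

theorem integrableOn_polar {G : Type*} [NormedAddCommGroup G] {F : ℝ × ℝ → G} {R : ℝ}
    (hF : Continuous F) (hR : ∀ r θ, R ≤ r → F (r, θ) = 0) :
    IntegrableOn F (Ioi 0 ×ˢ Ioo (-π) π) := by
  have hbox : IntegrableOn F (Icc 0 R ×ˢ Icc (-π) π) :=
    hF.continuousOn.integrableOn_compact (isCompact_Icc.prod isCompact_Icc)
  refine hbox.of_forall_sdiff_eq_zero (measurableSet_Ioi.prod measurableSet_Ioo) ?_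
  rintro ⟨r, θ⟩ ⟨⟨hr, hθ⟩, hrθ⟩
  refine hR r θ (le_of_not_ge fun h => hrθ ⟨⟨le_of_lt hr, h⟩, Ioo_subset_Icc_self hθ⟩)

theorem integrableOn_polar_clm {ψ : ℂ → ℂ →L[ℝ] ℂ} (hψ : Continuous ψ)
    (hc : HasCompactSupport ψ) {v : ℝ → ℂ} (hv : Continuous v) :
    IntegrableOn (fun p : ℝ × ℝ => ψ (p.1 * Complex.exp (p.2 * Complex.I)) (v p.2))
      (Ioi 0 ×ˢ Ioo (-π) π) := by
  obtain ⟨R, hR0, hR⟩ := hc.isCompact.isBounded.exists_pos_norm_lt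
  refine integrableOn_polar (R := R) (by fun_prop) fun r θ hr => ?_
  have hnorm : ‖(r : ℂ) * Complex.exp (θ * Complex.I)‖ = r := by
    rw [norm_mul, Complex.norm_exp_ofReal_mul_I, mul_one, Complex.norm_of_nonneg (by linarith)]
  have hzero : ψ (r * Complex.exp (θ * Complex.I)) = 0 :=
    image_eq_zero_of_notMem_tsupport fun h => (hR _ h).not_ge (hr.trans_eq hnorm.symm)
  simp [hzero]

theorem two_mul_wirtingerDbar_mul_conj (φ : ℂ → ℂ) (z e : ℂ) :
    2 * wirtingerDbar φ z * conj e
      = fderiv ℝ φ z e + Complex.I * fderiv ℝ φ z (Complex.I * e) := by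
  simp only [fderiv_apply_eq_wirtinger φ, map_mul, Complex.conj_I]
  linear_combination (wirtingerDbar φ z * conj e - wirtingerD φ z * e) * Complex.I_mul_I

theorem integral_inv_mul_wirtingerDbar_eq_polar (φ : ℂ → ℂ) :
    ∫ t : ℂ, t⁻¹ * wirtingerDbar φ t = ∫ p in Ioi (0 : ℝ) ×ˢ Ioo (-π) π,
      (1 / 2 * fderiv ℝ φ (p.1 * Complex.exp (p.2 * Complex.I)) (Complex.exp (p.2 * Complex.I))
        + Complex.I / 2 * fderiv ℝ φ (p.1 * Complex.exp (p.2 * Complex.I))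
          (Complex.I * Complex.exp (p.2 * Complex.I))) := by
  rw [← Complex.integral_comp_polarCoord_symm, polarCoord_target]
  refine setIntegral_congr_fun (measurableSet_Ioi.prod measurableSet_Ioo) ?_
  rintro ⟨r, θ⟩ ⟨hr, -⟩
  have hr : (r : ℂ) ≠ 0 := by exact_mod_cast (ne_of_gt hr)
  have hsymm : Complex.polarCoord.symm (r, θ) = r * Complex.exp (θ * Complex.I) := by
    rw [Complex.polarCoord_symm_apply, Complex.exp_mul_I]
    push_cast
    rfl
  have hinv : (Complex.exp (θ * Complex.I))⁻¹ = conj (Complex.exp (θ * Complex.I)) := by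
    rw [← Complex.exp_neg, ← Complex.exp_conj]
    simp
  have h := two_mul_wirtingerDbar_mul_conj φ (r * Complex.exp (θ * Complex.I))
    (Complex.exp (θ * Complex.I))
  simp only [hsymm, mul_inv, hinv, Complex.real_smul]
  rw [← mul_assoc, ← mul_assoc, mul_inv_cancel₀ hr]
  linear_combination (1 / 2) * h

theorem integral_inv_mul_wirtingerDbar {φ : ℂ → ℂ} (hφ : ContDiff ℝ 1 φ)
    (hc : HasCompactSupport φ) : ∫ t : ℂ, t⁻¹ * wirtingerDbar φ t = -π * φ 0 := by
  have hcont : Continuous (fderiv ℝ φ) := hφ.continuous_fderiv one_ne_zero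
  have hradial := integrableOn_polar_clm hcont (hc.fderiv ℝ)
    (v := fun θ => Complex.exp (θ * Complex.I)) (by fun_prop)
  have hangular := integrableOn_polar_clm hcont (hc.fderiv ℝ)
    (v := fun θ => Complex.I * Complex.exp (θ * Complex.I)) (by fun_prop)
  have hradial_eq : ∫ p in Ioi (0 : ℝ) ×ˢ Ioo (-π) π,
      fderiv ℝ φ (p.1 * Complex.exp (p.2 * Complex.I)) (Complex.exp (p.2 * Complex.I))
        = -(2 * π) * φ 0 := by
    rw [Measure.volume_eq_prod, ← setIntegral_prod_swap,
      setIntegral_prod (fun p : ℝ × ℝ => fderiv ℝ φ (p.swap.1 * _) _) hradial.swap]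
    have hray (θ : ℝ) : ∫ r in Ioi (0 : ℝ),
        fderiv ℝ φ (r * Complex.exp (θ * Complex.I)) (Complex.exp (θ * Complex.I)) = -φ 0 := by
      simpa only [Complex.real_smul] using
        integral_Ioi_fderiv_smul hφ hc (Complex.exp_ne_zero (θ * Complex.I))
    simp only [Prod.fst_swap, Prod.snd_swap, hray]
    simp [pi_pos.le, two_mul]
    ring
  have hangular_eq : ∫ p in Ioi (0 : ℝ) ×ˢ Ioo (-π) π,
      fderiv ℝ φ (p.1 * Complex.exp (p.2 * Complex.I))
        (Complex.I * Complex.exp (p.2 * Complex.I)) = 0 := by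
    rw [Measure.volume_eq_prod, setIntegral_prod _ hangular]
    refine setIntegral_eq_zero_of_forall_eq_zero fun r hr => ?_
    rw [← integral_Ioc_eq_integral_Ioo, ← intervalIntegral.integral_of_le (by linarith [pi_pos]),
      integral_fderiv_circle hφ (ne_of_gt hr)]
  rw [integral_inv_mul_wirtingerDbar_eq_polar,
    integral_add (hradial.const_mul _) (hangular.const_mul _), integral_const_mul,
    integral_const_mul, hradial_eq, hangular_eq]
  ring

/-- The Cauchy transform of `g`: its convolution with the fundamental solution `1 / (π z)` of `∂̄`,
which solves `∂̄ u = g` on the plane for compactly supported `g`. -/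
noncomputable def cauchyTransform (g : ℂ → ℂ) (z : ℂ) : ℂ :=
  ∫ t : ℂ, ((π : ℂ) * t)⁻¹ * g (z - t)

theorem cauchyTransform_eq_integral (g : ℂ → ℂ) (z : ℂ) :
    cauchyTransform g z = ∫ ζ : ℂ, ((π : ℂ) * (z - ζ))⁻¹ * g ζ := by
  rw [cauchyTransform, ← integral_sub_left_eq_self _ _ z]
  simp only [sub_sub_cancel]

theorem locallyIntegrable_cauchyKernel : LocallyIntegrable fun t : ℂ => ((π : ℂ) * t)⁻¹ := by
  refine locallyIntegrable_of_norm_le_rpow (C := π⁻¹) (α := 1) (by simp) (by simp)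
    (Filter.Eventually.of_forall fun t => ?_) (by fun_prop)
  rw [norm_inv, norm_mul, Complex.norm_real, norm_of_nonneg pi_pos.le, mul_inv, rpow_neg_one]

theorem cauchyTransform_eq_convolution (g : ℂ → ℂ) :
    cauchyTransform g = convolution (fun t : ℂ => ((π : ℂ) * t)⁻¹) g
      (ContinuousLinearMap.mul ℝ ℂ) volume := by
  ext z
  simp [cauchyTransform, convolution_def]

variable {g : ℂ → ℂ}

theorem contDiff_cauchyTransform {n : ℕ∞} (hg : ContDiff ℝ n g) (hc : HasCompactSupport g) :
    ContDiff ℝ n (cauchyTransform g) := by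
  rw [cauchyTransform_eq_convolution]
  exact hc.contDiff_convolution_right _ locallyIntegrable_cauchyKernel hg

theorem fderiv_cauchyTransform_apply (hg : ContDiff ℝ 1 g) (hc : HasCompactSupport g) (z v : ℂ) :
    fderiv ℝ (cauchyTransform g) z v = cauchyTransform (fun w => fderiv ℝ g w v) z := by
  rw [cauchyTransform_eq_convolution, (hc.hasFDerivAt_convolution_right
    (ContinuousLinearMap.mul ℝ ℂ) locallyIntegrable_cauchyKernel hg z).fderiv,
    convolution_precompR_apply _ locallyIntegrable_cauchyKernel (hc.fderiv ℝ)
      (hg.continuous_fderiv one_ne_zero), cauchyTransform_eq_convolution]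

theorem integrable_cauchyKernel_mul (hg : Continuous g) (hc : HasCompactSupport g) (z : ℂ) :
    Integrable fun t : ℂ => ((π : ℂ) * t)⁻¹ * g (z - t) :=
  hc.convolutionExists_right (ContinuousLinearMap.mul ℝ ℂ) locallyIntegrable_cauchyKernel hg z

theorem wirtingerDbar_cauchyTransform_eq (hg : ContDiff ℝ 1 g) (hc : HasCompactSupport g) (z : ℂ) :
    wirtingerDbar (cauchyTransform g) z = cauchyTransform (wirtingerDbar g) z := by
  have := hg.continuous_fderiv one_ne_zero
  have hint (v : ℂ) := integrable_cauchyKernel_mul (g := fun w => fderiv ℝ g w v) (by fun_prop)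
    (hc.fderiv_apply (𝕜 := ℝ) v) z
  rw [wirtingerDbar, fderiv_cauchyTransform_apply hg hc, fderiv_cauchyTransform_apply hg hc,
    cauchyTransform, cauchyTransform, ← integral_const_mul, ← integral_add (hint _)
    ((hint _).const_mul _), ← integral_div]
  refine integral_congr_ae (.of_forall fun t => ?_)
  simp only [wirtingerDbar]
  ring

theorem cauchyTransform_wirtingerDbar (hg : ContDiff ℝ 1 g) (hc : HasCompactSupport g) (z : ℂ) :
    cauchyTransform (wirtingerDbar g) z = g z := by
  have hcomp : HasCompactSupport fun w => g (z + w) := hc.comp_homeomorph (Homeomorph.addLeft z)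
  have htranslate (t : ℂ) : wirtingerDbar (fun w => g (z + w)) t = wirtingerDbar g (z + t) := by
    simp only [wirtingerDbar, fderiv_comp_add_left]
  have hpompeiu := integral_inv_mul_wirtingerDbar (by fun_prop) hcomp
  simp only [htranslate, add_zero] at hpompeiu
  have hpi : (π : ℂ) ≠ 0 := by exact_mod_cast pi_ne_zero
  calc cauchyTransform (wirtingerDbar g) z
      = ∫ t : ℂ, -(π : ℂ)⁻¹ * (t⁻¹ * wirtingerDbar g (z + t)) := by
        rw [cauchyTransform, ← integral_neg_eq_self]
        refine integral_congr_ae (.of_forall fun t => ?_)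
        simp only [mul_neg, inv_neg, mul_inv, sub_neg_eq_add]
        ring
    _ = g z := by
        rw [integral_const_mul, hpompeiu]
        field_simp

theorem wirtingerDbar_cauchyTransform (hg : ContDiff ℝ 1 g) (hc : HasCompactSupport g) (z : ℂ) :
    wirtingerDbar (cauchyTransform g) z = g z := by
  rw [wirtingerDbar_cauchyTransform_eq hg hc, cauchyTransform_wirtingerDbar hg hc]

end CauchyTransform

/-! ### Möbius coordinates and approximation of the Cauchy transform -/

section MobiusCoordinate

open Metric Set Topology

variable {W : Set ℂ} {c : ℂ} {u : ℂ → ℂ} {M : ℝ}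

/-- The exhaustion of an open set `W` by the compact sets of points of norm at most `M` and at
distance at least `1 / M` from the complement of `W`. -/
def exhaustingCompact (W : Set ℂ) (M : ℝ) : Set ℂ :=
  {z | ‖z‖ ≤ M ∧ ∀ b ∉ W, 1 ≤ M * ‖z - b‖}

theorem exhaustingCompact_subset : exhaustingCompact W M ⊆ W := by
  intro z hz
  by_contra hzW
  have h := hz.2 z hzW
  norm_num at h

theorem isCompact_exhaustingCompact : IsCompact (exhaustingCompact W M) := by
  refine (isCompact_closedBall (0 : ℂ) M).of_isClosed_subset ?_ fun z hz => by simpa using hz.1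
  simp only [exhaustingCompact, ofPred_and, ofPred_forall]
  exact (isClosed_le (by fun_prop) (by fun_prop)).inter
    (isClosed_biInter fun b _ => isClosed_le (by fun_prop) (by fun_prop))

theorem exists_exhaustingCompact_mem_nhds (hW : IsOpen W) {z₀ : ℂ} (hz₀ : z₀ ∈ W) :
    ∃ M, exhaustingCompact W M ∈ 𝓝 z₀ := by
  obtain ⟨ρ, hρ, hball⟩ := Metric.isOpen_iff.1 hW z₀ hz₀
  refine ⟨max (‖z₀‖ + ρ) (2 / ρ), ?_⟩
  filter_upwards [ball_mem_nhds z₀ (half_pos hρ)] with z hz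
  have hz : ‖z - z₀‖ < ρ / 2 := by rwa [mem_ball, dist_eq_norm] at hz
  refine ⟨le_max_of_le_left (by linarith [norm_le_insert' z z₀]), fun b hb => ?_⟩
  have hb₀ : ρ ≤ ‖z₀ - b‖ := by
    by_contra! h
    exact hb (hball (by rwa [mem_ball, dist_eq_norm, norm_sub_rev]))
  have hzb : ρ / 2 ≤ ‖z - b‖ := by
    linarith [norm_sub_le_norm_sub_add_norm_sub z₀ z b, norm_sub_rev z z₀]
  calc (1 : ℝ) = 2 / ρ * (ρ / 2) := by field_simp
    _ ≤ max (‖z₀‖ + ρ) (2 / ρ) * ‖z - b‖ := by gcongr; exact le_max_right _ _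

/-- `u` is the restriction to `W` of a Möbius transformation which has no pole in `W` and takes the
value `1` at `c`. -/
def IsMobiusCoordinate (W : Set ℂ) (c : ℂ) (u : ℂ → ℂ) : Prop :=
  u c = 1 ∧ ∃ α β δ η : ℂ, α * η - β * δ ≠ 0 ∧
    ∀ z ∈ W, δ * z + η ≠ 0 ∧ u z = (α * z + β) / (δ * z + η)

theorem isMobiusCoordinate_affine {a : ℂ} (ha : a ≠ c) :
    IsMobiusCoordinate W c fun z => (z - a) / (c - a) := by
  have hca : c - a ≠ 0 := sub_ne_zero.2 ha.symm
  exact ⟨div_self hca, 1, -a, 0, c - a, by simpa using hca,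
    fun z _ => ⟨by simpa using hca, by ring⟩⟩

theorem isMobiusCoordinate_inversion {b : ℂ} (hc : c ∈ W) (hb : b ∉ W) :
    IsMobiusCoordinate W c fun z => (c - b) / (z - b) := by
  have hne (z : ℂ) (hz : z ∈ W) : z - b ≠ 0 := sub_ne_zero.2 fun h => hb (h ▸ hz)
  exact ⟨div_self (hne c hc), 0, c - b, 1, -b,
    by simpa [sub_eq_zero, eq_comm] using hne c hc,
    fun z hz => ⟨by simpa [← sub_eq_add_neg] using hne z hz, by ring⟩⟩

/-- If some boundary point is close to `c` compared with `1 / ‖c‖`, invert at the nearest one;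
otherwise rescale. -/
theorem exists_isMobiusCoordinate_norm_lt (hW : IsOpen W) (hc : c ∈ W) :
    ∃ u, IsMobiusCoordinate W c u ∧
      ∀ M, c ∉ exhaustingCompact W (4 * M) → ∀ z ∈ exhaustingCompact W M, ‖u z‖ < 1 / 4 := by
  by_cases hclose : ∃ b ∉ W, ‖c‖ * ‖c - b‖ < 1
  · obtain ⟨b₁, hb₁, hcb₁⟩ := hclose
    obtain ⟨b, hb, hdist⟩ := hW.isClosed_compl.exists_infDist_eq_dist ⟨b₁, hb₁⟩ c
    have hnearest (b' : ℂ) (hb' : b' ∉ W) : ‖c - b‖ ≤ ‖c - b'‖ := by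
      simpa only [← hdist, ← dist_eq_norm] using infDist_le_dist_of_mem (s := Wᶜ) hb'
    refine ⟨_, isMobiusCoordinate_inversion hc hb, fun M hcM z hz => ?_⟩
    have hM : 0 ≤ M := (norm_nonneg z).trans hz.1
    have hcb : 4 * M * ‖c - b‖ < 1 := by
      by_contra! hfar
      refine hcM ⟨?_, fun b' hb' => hfar.trans (by gcongr; exact hnearest b' hb')⟩
      by_contra! hlt
      have hcb := (mul_le_mul_of_nonneg_left (hnearest b₁ hb₁) (norm_nonneg c)).trans_lt hcb₁
      exact absurd (mul_le_mul_of_nonneg_right hlt.le (norm_nonneg (c - b))) (by linarith)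
    have hzb := hz.2 b hb
    have hpos : 0 < ‖z - b‖ := norm_pos_iff.2 fun h => by norm_num [h] at hzb
    rw [norm_div, div_lt_iff₀ hpos]
    by_contra! hle
    nlinarith
  · push Not at hclose
    refine ⟨_, isMobiusCoordinate_affine (a := if c = 0 then 1 else 0) (by split_ifs <;> simp_all
      [eq_comm]), fun M hcM z hz => ?_⟩
    have hM : 0 ≤ M := (norm_nonneg z).trans hz.1
    have hcM' : 4 * M < ‖c‖ := by
      by_contra! hle
      refine hcM ⟨hle, fun b hb => (hclose b hb).trans (by gcongr)⟩
    have hc0 : 0 < ‖c‖ := by linarith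
    rw [if_neg (norm_pos_iff.1 hc0), sub_zero, sub_zero, norm_div, div_lt_iff₀ hc0]
    linarith [hz.1]

theorem exists_isMobiusCoordinate_family (hW : IsOpen W) :
    ∃ u : ℂ → ℂ → ℂ, (∀ c ∈ W, IsMobiusCoordinate W c (u c)) ∧
      ∀ z₀ ∈ W, ∃ N ∈ 𝓝 z₀, N ⊆ W ∧ ∃ K ⊆ W, IsCompact K ∧
        ∀ c ∈ W \ K, ∀ z ∈ N, ‖u c z‖ < 1 / 4 := by
  choose! u hu hsmall using fun c (hc : c ∈ W) => exists_isMobiusCoordinate_norm_lt hW hc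
  refine ⟨u, hu, fun z₀ hz₀ => ?_⟩
  obtain ⟨M, hM⟩ := exists_exhaustingCompact_mem_nhds hW hz₀
  exact ⟨_, hM, exhaustingCompact_subset, exhaustingCompact W (4 * M), exhaustingCompact_subset,
    isCompact_exhaustingCompact, fun c hc => hsmall c hc.1 M hc.2⟩

namespace IsMobiusCoordinate

theorem differentiableOn (hu : IsMobiusCoordinate W c u) : DifferentiableOn ℂ u W := by
  obtain ⟨-, α, β, δ, η, -, h⟩ := hu
  have hq : DifferentiableOn ℂ (fun z => (α * z + β) / (δ * z + η)) W :=
    DifferentiableOn.div (by fun_prop) (by fun_prop) fun z hz => (h z hz).1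
  exact hq.congr fun z hz => (h z hz).2

theorem exists_closedBall (hu : IsMobiusCoordinate W c u) (hW : IsOpen W) (hc : c ∈ W) :
    ∃ R > 0, ∀ z ∈ closedBall c R, z ∈ W ∧ 1 / 2 ≤ ‖u z‖ := by
  have hcont : ContinuousAt (fun z => ‖u z‖) c :=
    (hu.differentiableOn.continuousOn.continuousAt (hW.mem_nhds hc)).norm
  have hlarge : ∀ᶠ z in 𝓝 c, z ∈ W ∧ 1 / 2 ≤ ‖u z‖ :=
    (hW.eventually_mem hc).and (hcont.eventually (le_mem_nhds (by norm_num [hu.1])))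
  exact nhds_basis_closedBall.mem_iff.1 hlarge

theorem exists_sub_eq (hu : IsMobiusCoordinate W c u) : ∃ (κ : ℂ) (γ : ℂ → ℂ),
    κ ≠ 0 ∧ DifferentiableOn ℂ γ W ∧ (∀ z ∈ W, γ z ≠ 0) ∧
    (∀ z ∈ W, ∀ ζ ∈ W, u z - u ζ = κ * γ z * γ ζ * (z - ζ)) ∧
    ∃ C, ∀ z ∈ W, ‖u z‖ < 1 / 4 → ‖γ z‖ ≤ C := by
  obtain ⟨-, α, β, δ, η, hdet, h⟩ := hu
  refine ⟨α * η - β * δ, fun z => (δ * z + η)⁻¹, hdet, DifferentiableOn.inv (by fun_prop)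
    fun z hz => (h z hz).1, fun z hz => inv_ne_zero (h z hz).1, fun z hz ζ hζ => ?_,
    ‖α * η - β * δ‖⁻¹ * (‖α‖ + ‖δ‖), fun z hz huz => ?_⟩
  · obtain ⟨hz0, huz⟩ := h z hz
    obtain ⟨hζ0, huζ⟩ := h ζ hζ
    rw [huz, huζ, div_sub_div _ _ hz0 hζ0, div_eq_mul_inv, mul_inv]
    ring
  · obtain ⟨hz0, huz'⟩ := h z hz
    have hγ : (δ * z + η)⁻¹ = (α * η - β * δ)⁻¹ * (α - δ * u z) := by
      rw [eq_inv_mul_iff_mul_eq₀ hdet, huz']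
      field_simp
      ring
    dsimp only
    rw [hγ, norm_mul, norm_inv]
    gcongr
    refine (norm_sub_le _ _).trans (add_le_add_right ?_ _)
    rw [norm_mul]
    exact mul_le_of_le_one_right (norm_nonneg _) (by linarith)

end IsMobiusCoordinate

end MobiusCoordinate

section Approximation

open MeasureTheory

theorem norm_inv_one_sub_sub_geom_sum_le {x : ℂ} (hx : ‖x‖ ≤ 1 / 2) (N : ℕ) :
    ‖(1 - x)⁻¹ - ∑ n ∈ Finset.range N, x ^ n‖ ≤ 2 * (1 / 2) ^ N := by
  have hlow : 1 / 2 ≤ ‖1 - x‖ := by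
    have := norm_sub_norm_le 1 x
    rw [norm_one] at this
    linarith
  have hne : 1 - x ≠ 0 := norm_pos_iff.1 (by linarith)
  have hremainder : (1 - x)⁻¹ - ∑ n ∈ Finset.range N, x ^ n = (1 - x)⁻¹ * x ^ N := by
    rw [(eq_mul_inv_iff_mul_eq₀ hne).2 (geom_sum_mul_neg x N)]
    ring
  rw [hremainder, norm_mul, norm_pow, norm_inv]
  gcongr
  exact inv_le_of_inv_le₀ two_pos (by linarith)

theorem norm_mul_inv_one_sub_sub_sum_le {a b w v : ℂ} (hwv : ‖w * v‖ ≤ 1 / 2) (N : ℕ) :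
    ‖a * b * (1 - w * v)⁻¹ - ∑ n ∈ Finset.range N, b * v ^ n * (a * w ^ n)‖
      ≤ ‖a‖ * (2 * (1 / 2) ^ N) * ‖b‖ := by
  have hfactor : a * b * (1 - w * v)⁻¹ - ∑ n ∈ Finset.range N, b * v ^ n * (a * w ^ n)
      = a * ((1 - w * v)⁻¹ - ∑ n ∈ Finset.range N, (w * v) ^ n) * b := by
    rw [mul_sub, sub_mul, Finset.mul_sum, Finset.sum_mul]
    congr 1
    · ring
    · exact Finset.sum_congr rfl fun n _ => by ring
  rw [hfactor, norm_mul, norm_mul]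
  gcongr
  exact norm_inv_one_sub_sub_geom_sum_le hwv N

theorem exists_norm_integral_neumann_sub_le {X : Type*} [MeasurableSpace X] {μ : Measure X}
    {β v : X → ℂ} (hβ : Integrable β μ) (hv : AEStronglyMeasurable v μ) {B : ℝ}
    (hvB : ∀ᵐ ζ ∂μ, ‖v ζ‖ ≤ B) {a w : ℂ → ℂ} {W S : Set ℂ} (ha : DifferentiableOn ℂ a W)
    (hw : DifferentiableOn ℂ w W) {C : ℝ} (haC : ∀ z ∈ S, ‖a z‖ ≤ C)
    (hwB : ∀ z ∈ S, ‖w z‖ * B ≤ 1 / 2) {ε : ℝ} (hε : 0 < ε) :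
    ∃ P : ℂ → ℂ, DifferentiableOn ℂ P W ∧
      ∀ z ∈ S, ‖(∫ ζ, a z * β ζ * (1 - w z * v ζ)⁻¹ ∂μ) - P z‖ ≤ ε := by
  obtain ⟨N, hN⟩ : ∃ N : ℕ, (1 / 2 : ℝ) ^ N * (2 * C * ∫ ζ, ‖β ζ‖ ∂μ) ≤ ε := by
    have h := (tendsto_pow_atTop_nhds_zero_of_lt_one (r := (1 / 2 : ℝ)) (by norm_num)
      (by norm_num)).mul_const (2 * C * ∫ ζ, ‖β ζ‖ ∂μ)
    rw [zero_mul] at h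
    exact (h.eventually (ge_mem_nhds hε)).exists
  have hβv (n : ℕ) : Integrable (fun ζ => β ζ * v ζ ^ n) μ :=
    hβ.mul_bdd (c := B ^ n) (hv.pow n) (hvB.mono fun ζ hζ => by
      rw [norm_pow]
      gcongr)
  refine ⟨fun z => ∑ n ∈ Finset.range N, (∫ ζ, β ζ * v ζ ^ n ∂μ) * (a z * w z ^ n),
    by fun_prop, fun z hz => ?_⟩
  have hwv : ∀ᵐ ζ ∂μ, ‖w z * v ζ‖ ≤ 1 / 2 := hvB.mono fun ζ hζ => by
    rw [norm_mul]
    exact (mul_le_mul_of_nonneg_left hζ (norm_nonneg _)).trans (hwB z hz)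
  have hint : Integrable (fun ζ => a z * β ζ * (1 - w z * v ζ)⁻¹) μ :=
    (hβ.const_mul (a z)).mul_bdd (c := 2)
      (aestronglyMeasurable_const.sub (hv.const_mul (w z))).inv₀
      (hwv.mono fun ζ hζ => by simpa using norm_inv_one_sub_sub_geom_sum_le hζ 0)
  have hsum : ∑ n ∈ Finset.range N, (∫ ζ, β ζ * v ζ ^ n ∂μ) * (a z * w z ^ n)
      = ∫ ζ, ∑ n ∈ Finset.range N, β ζ * v ζ ^ n * (a z * w z ^ n) ∂μ := by
    rw [integral_finsetSum _ fun n _ => (hβv n).mul_const _]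
    simp only [integral_mul_const]
  dsimp only
  rw [hsum, ← integral_sub hint (integrable_finsetSum _ fun n _ => (hβv n).mul_const _)]
  refine (norm_integral_le_of_norm_le (hβ.norm.const_mul (C * (2 * (1 / 2) ^ N))) ?_).trans
    (by rw [integral_const_mul]; linarith)
  filter_upwards [hwv] with ζ hζ
  refine (norm_mul_inv_one_sub_sub_sum_le hζ N).trans ?_
  gcongr
  exact haC z hz

/-- The Cauchy kernel is a geometric series in `u z / u ζ`, since Möbius transformations preserve
cross-ratios. -/
theorem IsMobiusCoordinate.exists_approx {W : Set ℂ} {c : ℂ} {u g : ℂ → ℂ} {K : Set ℂ}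
    (hu : IsMobiusCoordinate W c u) (hg : Continuous g) (hK : IsCompact K) (hKW : K ⊆ W)
    (hgK : Function.support g ⊆ K) (huK : ∀ ζ ∈ K, 1 / 2 ≤ ‖u ζ‖) {ε : ℝ} (hε : 0 < ε) :
    ∃ P : ℂ → ℂ, DifferentiableOn ℂ P W ∧
      ∀ z ∈ W, ‖u z‖ < 1 / 4 → ‖cauchyTransform g z - P z‖ ≤ ε := by
  obtain ⟨κ, γ, hκ, hγ, hγ0, hsub, C, hC⟩ := hu.exists_sub_eq
  have hu0 (ζ : ℂ) (hζ : ζ ∈ K) : u ζ ≠ 0 := norm_pos_iff.1 (by linarith [huK ζ hζ])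
  have huinv : ContinuousOn (fun ζ => (u ζ)⁻¹) K :=
    (hu.differentiableOn.continuousOn.mono hKW).inv₀ hu0
  have hγK : ContinuousOn γ K := hγ.continuousOn.mono hKW
  have hβ : IntegrableOn (fun ζ => -κ * γ ζ * (u ζ)⁻¹ * ((Real.pi : ℂ)⁻¹ * g ζ)) K :=
    ContinuousOn.integrableOn_compact hK (by fun_prop)
  obtain ⟨P, hP, happrox⟩ := exists_norm_integral_neumann_sub_le hβ
    (huinv.aestronglyMeasurable hK.measurableSet)
    (ae_restrict_of_forall_mem hK.measurableSet fun ζ hζ => by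
      rw [norm_inv]
      exact inv_le_of_inv_le₀ two_pos (by linarith [huK ζ hζ]))
    (S := {z ∈ W | ‖u z‖ < 1 / 4}) hγ hu.differentiableOn (fun z hz => hC z hz.1 hz.2)
    (fun z hz => by linarith [hz.2]) hε
  refine ⟨P, hP, fun z hz huz => ?_⟩
  convert happrox z ⟨hz, huz⟩ using 3
  rw [cauchyTransform_eq_integral, ← setIntegral_eq_integral_of_forall_compl_eq_zero (s := K)
    fun ζ hζ => by rw [Function.notMem_support.1 fun h => hζ (hgK h), mul_zero]]
  refine setIntegral_congr_fun hK.measurableSet fun ζ hζ => ?_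
  have huzζ : u z - u ζ ≠ 0 := sub_ne_zero.2 fun h => by
    linarith [huK ζ hζ, congrArg norm h]
  have hzζ : z - ζ ≠ 0 := fun h => huzζ (by rw [hsub z hz ζ (hKW hζ), h, mul_zero])
  have hkernel : (z - ζ)⁻¹ = -κ * γ z * γ ζ * (u ζ)⁻¹ * (1 - u z * (u ζ)⁻¹)⁻¹ := by
    have hfactor : 1 - u z * (u ζ)⁻¹ = -(κ * γ z * γ ζ * (z - ζ)) * (u ζ)⁻¹ := by
      rw [← hsub z hz ζ (hKW hζ)]
      field_simp [hu0 ζ hζ]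
      ring
    have := hu0 ζ hζ
    have := hγ0 z hz
    have := hγ0 ζ (hKW hζ)
    rw [hfactor]
    field_simp
  simp only [mul_inv, hkernel]
  ring

end Approximation

/-! ### The inhomogeneous Cauchy–Riemann equation -/

section LocallyFiniteOn

open Topology

variable {X ι : Type*} [TopologicalSpace X] {W : Set X} {s t : ι → Set X} {x : X}

/-- Local finiteness of a family of sets near the points of `W`; nothing is required at the other
points of the space. -/
def LocallyFiniteOn (s : ι → Set X) (W : Set X) : Prop :=
  LocallyFinite fun i => ((↑) ⁻¹' s i : Set W)

namespace LocallyFiniteOn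

theorem mono (hs : LocallyFiniteOn s W) (h : ∀ i, t i ∩ W ⊆ s i) : LocallyFiniteOn t W :=
  LocallyFinite.subset hs fun i x hx => h i ⟨hx, x.2⟩

theorem finite_inter_of_isCompact (hs : LocallyFiniteOn s W) {K : Set X} (hK : IsCompact K)
    (hKW : K ⊆ W) : {i | (s i ∩ K).Nonempty}.Finite := by
  have hK' : IsCompact ((↑) ⁻¹' K : Set W) :=
    Topology.IsInducing.subtypeVal.isCompact_preimage_iff (by rwa [Subtype.range_coe]) |>.2 hK
  refine (LocallyFinite.finite_nonempty_inter_compact hs hK').subset ?_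
  rintro i ⟨x, hx, hxK⟩
  exact ⟨⟨x, hKW hxK⟩, hx, hxK⟩

theorem exists_finset_eventually (hs : LocallyFiniteOn s W) (hW : IsOpen W) (hx : x ∈ W) :
    ∃ F : Finset ι, ∀ᶠ y in 𝓝 x, ∀ i ∉ F, y ∉ s i := by
  obtain ⟨N, hN, hfin⟩ := hs ⟨x, hx⟩
  refine ⟨hfin.toFinset, ?_⟩
  filter_upwards [hW.isOpenEmbedding_subtypeVal.image_mem_nhds.2 hN]
  rintro _ ⟨y, hyN, rfl⟩ i hi hy
  exact hi (hfin.mem_toFinset.2 ⟨y, hy, hyN⟩)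

@[to_additive]
theorem exists_finset_finprod_eq {M : Type*} [CommMonoid M] {f : ι → X → M}
    (hf : LocallyFiniteOn (fun i => Function.mulSupport (f i)) W) (hW : IsOpen W) (hx : x ∈ W) :
    ∃ F : Finset ι, (∀ i ∉ F, f i x = 1) ∧ ∀ᶠ y in 𝓝 x, ∏ᶠ i, f i y = ∏ i ∈ F, f i y := by
  obtain ⟨F, hF⟩ := hf.exists_finset_eventually hW hx
  refine ⟨F, fun i hi => Function.notMem_mulSupport.1 (hF.self_of_nhds i hi),
    hF.mono fun y hy => finprod_eq_prod_of_mulSupport_subset _ fun i hi => ?_⟩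
  by_contra hiF
  exact hy i hiF hi

end LocallyFiniteOn

end LocallyFiniteOn

section PartitionOfUnity

open Metric Set Topology

universe v

variable {E : Type v} [NormedAddCommGroup E] [NormedSpace ℝ E] {W : Set E}

theorem LocallyFiniteOn.contDiffOn_finsum {ι F : Type*} [NormedAddCommGroup F] [NormedSpace ℝ F]
    {f : ι → E → F} (hf : LocallyFiniteOn (fun i => Function.support (f i)) W) (hW : IsOpen W)
    {n : WithTop ℕ∞} (hfn : ∀ i, ContDiffOn ℝ n (f i) W) :
    ContDiffOn ℝ n (fun x => ∑ᶠ i, f i x) W := fun x hx => by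
  obtain ⟨s, -, hs⟩ := hf.exists_finset_finsum_eq hW hx
  have hsum : ContDiffAt ℝ n (fun y => ∑ i ∈ s, f i y) x :=
    ContDiffAt.sum fun i _ => (hfn i).contDiffAt (hW.mem_nhds hx)
  exact (hsum.congr_of_eventuallyEq hs).contDiffWithinAt

theorem contDiff_smul_of_tsupport_subset {F : Type*} [NormedAddCommGroup F] [NormedSpace ℝ F]
    {b : E → ℝ} {g : E → F} {n : WithTop ℕ∞} (hb : ContDiff ℝ n b) (hbW : tsupport b ⊆ W)
    (hW : IsOpen W) (hg : ContDiffOn ℝ n g W) : ContDiff ℝ n fun x => b x • g x :=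
  contDiff_iff_contDiffAt.2 fun x => by
    by_cases hx : x ∈ W
    · exact hb.contDiffAt.smul (hg.contDiffAt (hW.mem_nhds hx))
    · refine (contDiffAt_const (c := (0 : F))).congr_of_eventuallyEq ?_
      filter_upwards [notMem_tsupport_iff_eventuallyEq.1 fun h => hx (hbW h)] with y hy
      simp [hy]

variable [FiniteDimensional ℝ E] {R : E → ℝ}

theorem exists_locallyFiniteOn_ball_cover (hW : IsOpen W)
    (hR : ∀ x ∈ W, 0 < R x ∧ closedBall x (R x) ⊆ W) :
    ∃ (ι : Type v) (c : ι → E) (ρ : ι → ℝ), (∀ i, c i ∈ W ∧ 0 < ρ i ∧ ρ i ≤ R (c i)) ∧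
      LocallyFiniteOn (fun i => ball (c i) (ρ i)) W ∧ ∀ x ∈ W, ∃ i, x ∈ ball (c i) (ρ i) := by
  have hbasis (x : W) : (𝓝 x).HasBasis (fun ρ : ℝ => 0 < ρ ∧ ρ ≤ R x) (ball x) :=
    nhds_basis_ball.restrict fun ρ hρ =>
      ⟨min ρ (R x), lt_min hρ (hR x x.2).1, min_le_right _ _, ball_subset_ball (min_le_left _ _)⟩
  have : LocallyCompactSpace W := hW.locallyCompactSpace
  obtain ⟨ι, c, ρ, hρ, hcover, hfin⟩ :=
    refinement_of_locallyCompact_sigmaCompact_of_nhds_basis hbasis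
  refine ⟨ι, fun i => c i, ρ, fun i => ⟨(c i).2, hρ i⟩, hfin, fun x hx => ?_⟩
  obtain ⟨i, hi⟩ := mem_iUnion.1 (hcover.superset (mem_univ (⟨x, hx⟩ : W)))
  exact ⟨i, hi⟩

theorem exists_smooth_partition_of_unity (hW : IsOpen W)
    (hR : ∀ x ∈ W, 0 < R x ∧ closedBall x (R x) ⊆ W) :
    ∃ (ι : Type v) (c : ι → E) (f : ι → E → ℝ), Countable ι ∧
      (∀ i, c i ∈ W ∧ c i ∈ Function.support (f i) ∧ ContDiff ℝ ∞ (f i) ∧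
        tsupport (f i) ⊆ closedBall (c i) (R (c i))) ∧
      LocallyFiniteOn (fun i => Function.support (f i)) W ∧ ∀ x ∈ W, ∑ᶠ i, f i x = 1 := by
  obtain ⟨ι, c, ρ, hcρ, hfin, hcover⟩ := exists_locallyFiniteOn_ball_cover hW hR
  choose b hb hbs hb01 using fun i =>
    (isOpen_ball (x := c i) (ε := ρ i)).exists_contDiff_support_eq (n := ⊤)
  have hbfin : LocallyFiniteOn (fun i => Function.support (b i)) W := by simpa only [hb] using hfin
  have hb0 (i : ι) (x : E) : 0 ≤ b i x := (hb01 i ⟨x, rfl⟩).1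
  have hbsupp (i : ι) : tsupport (b i) ⊆ closedBall (c i) (R (c i)) := by
    rw [tsupport, hb]
    exact closure_ball_subset_closedBall.trans (closedBall_subset_closedBall (hcρ i).2.2)
  have hSs : ContDiffOn ℝ ∞ (fun x => ∑ᶠ i, b i x) W :=
    hbfin.contDiffOn_finsum hW fun i => (hbs i).contDiffOn
  have hSpos (x : E) (hx : x ∈ W) : 0 < ∑ᶠ i, b i x := by
    obtain ⟨i, hi⟩ := hcover x hx
    rw [← hb] at hi
    exact finsum_pos (fun j => hb0 j x) ⟨i, (hb0 i x).lt_of_ne' hi⟩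
      ((hbfin.point_finite ⟨x, hx⟩).subset fun j hj => hj)
  have hsupp (i : ι) : Function.support (fun x => b i x • (∑ᶠ j, b j x)⁻¹)
      ⊆ Function.support (b i) := fun x hx h => hx (by simp [h])
  refine ⟨ι, c, fun i x => b i x • (∑ᶠ j, b j x)⁻¹, ?_, fun i => ⟨(hcρ i).1, ?_, ?_, ?_⟩,
    hbfin.mono fun i => inter_subset_left.trans (hsupp i), fun x hx => ?_⟩
  · have : LocallyCompactSpace W := hW.locallyCompactSpace
    exact countable_univ_iff.1 (hfin.countable_univ fun i =>
      ⟨⟨c i, (hcρ i).1⟩, mem_ball_self (hcρ i).2.1⟩)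
  · have hci : b i (c i) ≠ 0 := by
      rw [← Function.mem_support, hb]
      exact mem_ball_self (hcρ i).2.1
    exact smul_ne_zero hci (inv_ne_zero (hSpos _ (hcρ i).1).ne')
  · exact contDiff_smul_of_tsupport_subset (hbs i) ((hbsupp i).trans (hR _ (hcρ i).1).2) hW
      (hSs.inv fun x hx => (hSpos x hx).ne')
  · exact (closure_mono (hsupp i)).trans (hbsupp i)
  · simp only [smul_eq_mul]
    rw [← finsum_mul, mul_inv_cancel₀ (hSpos x hx).ne']

end PartitionOfUnity

section DbarEquation

open Filter Metric Topology

variable {W : Set ℂ} {g : ℂ → ℂ} {ι : Type*} {D : ι → ℂ → ℂ} {ε : ι → ℝ} {z : ℂ}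

theorem exists_tsum_eq_sum_add_differentiableAt (hW : IsOpen W) (hz : z ∈ W)
    (hD : ∀ i, DifferentiableOn ℝ (D i) W)
    (hfin : LocallyFiniteOn (fun i => Function.support (wirtingerDbar (D i))) W)
    (hε : Summable ε) {N : Set ℂ} (hN : N ∈ 𝓝 z) (hsmall : {i | ¬ ∀ w ∈ N, ‖D i w‖ ≤ ε i}.Finite) :
    ∃ (F : Finset ι) (H : ℂ → ℂ), (∀ᶠ w in 𝓝 z, DifferentiableAt ℂ H w) ∧
      (∀ᶠ w in 𝓝 z, ∑' i, D i w = ∑ i ∈ F, D i w + H w) ∧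
      ∀ i ∉ F, wirtingerDbar (D i) z = 0 := by
  classical
  obtain ⟨F, hF⟩ := hfin.exists_finset_eventually hW hz
  obtain ⟨N', hN', hN'o, hzN'⟩ := _root_.mem_nhds_iff.1 (inter_mem (inter_mem hN hF)
    (hW.mem_nhds hz))
  have hbound (i : {i // i ∉ F ∪ hsmall.toFinset}) (w : ℂ) (hw : w ∈ N') : ‖D i w‖ ≤ ε i := by
    obtain ⟨i, hi⟩ := i
    by_contra h
    exact hi (Finset.mem_union_right _ (hsmall.mem_toFinset.2 fun h' => h (h' w (hN' hw).1.1)))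
  have hhol (i : {i // i ∉ F ∪ hsmall.toFinset}) : DifferentiableOn ℂ (D i) N' := fun w hw =>
    (differentiableAt_of_wirtingerDbar_eq_zero ((hD i).differentiableAt (hW.mem_nhds (hN' hw).2))
      (by_contra ((hN' hw).1.2 i fun h => i.2 (Finset.mem_union_left _ h)))).differentiableWithinAt
  have hε' : Summable fun i : {i // i ∉ F ∪ hsmall.toFinset} => ε i :=
    hε.comp_injective Subtype.val_injective
  refine ⟨F ∪ hsmall.toFinset, fun w => ∑' i : {i // i ∉ F ∪ hsmall.toFinset}, D i w, ?_, ?_,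
    fun i hi => by_contra ((hN' hzN').1.2 i fun h => hi (Finset.mem_union_left _ h))⟩
  · filter_upwards [hN'o.mem_nhds hzN'] with w hw
    exact (Complex.differentiableOn_tsum_of_summable_norm hε' hhol hN'o hbound).differentiableAt
      (hN'o.mem_nhds hw)
  · filter_upwards [hN'o.mem_nhds hzN'] with w hw
    have hsum : Summable fun i => D i w := by
      rw [← (F ∪ hsmall.toFinset).summable_compl_iff]
      exact Summable.of_norm_bounded hε' fun i => hbound i w hw
    exact (hsum.sum_add_tsum_subtype_compl _).symm

theorem contDiffOn_and_wirtingerDbar_tsum (hW : IsOpen W) (hD : ∀ i, ContDiffOn ℝ ∞ (D i) W)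
    (hfin : LocallyFiniteOn (fun i => Function.support (wirtingerDbar (D i))) W)
    (hε : Summable ε)
    (hsmall : ∀ z ∈ W, ∃ N ∈ 𝓝 z, {i | ¬ ∀ w ∈ N, ‖D i w‖ ≤ ε i}.Finite) :
    ContDiffOn ℝ ∞ (fun z => ∑' i, D i z) W ∧
      ∀ z ∈ W, wirtingerDbar (fun z => ∑' i, D i z) z = ∑ᶠ i, wirtingerDbar (D i) z := by
  have hDd (i : ι) : DifferentiableOn ℝ (D i) W := (hD i).differentiableOn (by simp)
  refine ⟨fun z hz => ?_, fun z hz => ?_⟩ <;>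
  obtain ⟨N, hN, hNfin⟩ := hsmall z hz <;>
  obtain ⟨F, H, hH, heq, hF⟩ :=
    exists_tsum_eq_sum_add_differentiableAt hW hz hDd hfin hε hN hNfin
  · have hHs : ContDiffAt ℝ ∞ H z :=
      (Complex.analyticAt_iff_eventually_differentiableAt.2 hH).contDiffAt.restrict_scalars ℝ
    have hFs : ContDiffAt ℝ ∞ (fun w => ∑ i ∈ F, D i w) z :=
      ContDiffAt.sum fun i _ => (hD i).contDiffAt (hW.mem_nhds hz)
    exact ((hFs.add hHs).congr_of_eventuallyEq heq).contDiffWithinAt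
  · have hDz (i : ι) (_ : i ∈ F) : DifferentiableAt ℝ (D i) z :=
      (hDd i).differentiableAt (hW.mem_nhds hz)
    have hHz : DifferentiableAt ℂ H z := hH.self_of_nhds
    rw [wirtingerDbar_congr heq, wirtingerDbar_add (DifferentiableAt.fun_sum hDz)
      (hHz.restrictScalars ℝ), wirtingerDbar_sum F hDz, wirtingerDbar_eq_zero hHz, add_zero,
      finsum_eq_sum_of_support_subset _ fun i hi => ?_]
    by_contra hiF
    exact hi (hF i hiF)

theorem IsMobiusCoordinate.exists_wirtingerDbar_eq_norm_le {c : ℂ} {u : ℂ → ℂ} {K : Set ℂ}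
    (hu : IsMobiusCoordinate W c u) (hW : IsOpen W) (hK : IsCompact K) (hKW : K ⊆ W)
    (huK : ∀ ζ ∈ K, 1 / 2 ≤ ‖u ζ‖) (hg : ContDiff ℝ ∞ g) (hgK : Function.support g ⊆ K)
    {δ : ℝ} (hδ : 0 < δ) :
    ∃ D : ℂ → ℂ, ContDiffOn ℝ ∞ D W ∧ (∀ z ∈ W, wirtingerDbar D z = g z) ∧
      ∀ z ∈ W, ‖u z‖ < 1 / 4 → ‖D z‖ ≤ δ := by
  obtain ⟨P, hP, happrox⟩ := hu.exists_approx hg.continuous hK hKW hgK huK hδ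
  have hgc : HasCompactSupport g := HasCompactSupport.of_support_subset_isCompact hK hgK
  have hC : ContDiff ℝ ∞ (cauchyTransform g) := contDiff_cauchyTransform hg hgc
  refine ⟨fun z => cauchyTransform g z + -P z,
    hC.contDiffOn.add ((hP.contDiffOn hW).restrict_scalars ℝ).neg, fun z hz => ?_,
    by simpa only [sub_eq_add_neg] using happrox⟩
  have hPz : DifferentiableAt ℂ (fun z => -P z) z := (hP.differentiableAt (hW.mem_nhds hz)).neg
  rw [wirtingerDbar_add (hC.differentiable (by simp) z) (hPz.restrictScalars ℝ),
    wirtingerDbar_eq_zero hPz, add_zero, wirtingerDbar_cauchyTransform (hg.of_le (by simp)) hgc]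

/-- Correcting each summand of a locally finite decomposition of `g` by a holomorphic function makes
the solutions for the summands small away from their centres, so that their sum converges. -/
theorem exists_wirtingerDbar_eq (hW : IsOpen W) (hg : ContDiffOn ℝ ∞ g W) :
    ∃ h : ℂ → ℂ, ContDiffOn ℝ ∞ h W ∧ ∀ z ∈ W, wirtingerDbar h z = g z := by
  obtain ⟨u, hu, hfar⟩ := exists_isMobiusCoordinate_family hW
  choose! R hR hRu using fun c (hc : c ∈ W) => (hu c hc).exists_closedBall hW hc
  have hRW (c : ℂ) (hc : c ∈ W) : closedBall c (R c) ⊆ W := fun z hz => (hRu c hc z hz).1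
  obtain ⟨ι, c, f, hcount, hf, hfin, hone⟩ :=
    exists_smooth_partition_of_unity hW fun c hc => ⟨hR c hc, hRW c hc⟩
  have hG (i : ι) : ContDiff ℝ ∞ fun z => f i z • g z :=
    contDiff_smul_of_tsupport_subset (hf i).2.2.1 ((hf i).2.2.2.trans (hRW _ (hf i).1)) hW hg
  have hGsupp (i : ι) : Function.support (fun z => f i z • g z) ⊆ closedBall (c i) (R (c i)) :=
    (Function.support_smul_subset_left _ _).trans ((subset_tsupport _).trans (hf i).2.2.2)
  obtain ⟨ε, hε, _, hsum, -⟩ := NNReal.exists_pos_sum_of_countable one_ne_zero ι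
  choose D hD hDbar hDε using fun i => (hu _ (hf i).1).exists_wirtingerDbar_eq_norm_le hW
    (isCompact_closedBall _ _) (hRW _ (hf i).1) (fun ζ hζ => (hRu _ (hf i).1 ζ hζ).2) (hG i)
    (hGsupp i) (NNReal.coe_pos.2 (hε i))
  have hDfin : LocallyFiniteOn (fun i => Function.support (wirtingerDbar (D i))) W :=
    hfin.mono fun i z hz h => hz.1 (by rw [hDbar i z hz.2, h, zero_smul])
  obtain ⟨hsmooth, hdbar⟩ := contDiffOn_and_wirtingerDbar_tsum hW hD hDfin
    (NNReal.summable_coe.2 ⟨_, hsum⟩) fun z₀ hz₀ => by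
      obtain ⟨N, hN, hNW, K, hKW, hK, hsmall⟩ := hfar z₀ hz₀
      refine ⟨N, hN, (hfin.finite_inter_of_isCompact hK hKW).subset fun i hi => ?_⟩
      by_contra hiK
      exact hi fun z hz => hDε i z (hNW hz)
        (hsmall (c i) ⟨(hf i).1, fun h => hiK ⟨c i, (hf i).2.1, h⟩⟩ z hz)
  refine ⟨_, hsmooth, fun z hz => ?_⟩
  rw [hdbar z hz, finsum_congr fun i => hDbar i z hz, ← finsum_smul, hone z hz, one_smul]

end DbarEquation

/-! ### A smooth Weierstrass product -/

section SmoothlyAssociatedAt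

open Metric Topology

theorem mul_add_smul_mul_sub_ne_zero {n x y : ℂ} {t : ℝ} (hn : n ≠ 0) (ht0 : 0 ≤ t) (ht1 : t ≤ 1)
    (hxy : ‖y - x‖ < ‖x‖) : n * x + t • (n * (y - x)) ≠ 0 := by
  intro h
  have hx : x = -(t * (y - x)) := by
    refine mul_left_cancel₀ hn ?_
    rw [Complex.real_smul] at h
    linear_combination h
  refine hxy.not_ge ?_
  calc ‖x‖ = t * ‖y - x‖ := by
        conv_lhs => rw [hx, norm_neg, norm_mul, Complex.norm_real, Real.norm_of_nonneg ht0]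
    _ ≤ ‖y - x‖ := mul_le_of_le_one_left (norm_nonneg _) ht1

/-- The germs of `G` and `q` at `c` differ by an invertible germ of a smooth function, so that `G`
vanishes at `c` in the same way as `q`. -/
def SmoothlyAssociatedAt (G q : ℂ → ℂ) (c : ℂ) : Prop :=
  ∃ n : ℂ → ℂ, (∀ᶠ z in 𝓝 c, ContDiffAt ℝ ∞ n z) ∧ n c ≠ 0 ∧ ∀ᶠ z in 𝓝 c, G z = n z * q z

namespace SmoothlyAssociatedAt

variable {G q ℓ m : ℂ → ℂ} {c : ℂ}

theorem mul_left (h : SmoothlyAssociatedAt G q c) (hm : ∀ᶠ z in 𝓝 c, ContDiffAt ℝ ∞ m z)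
    (hm0 : m c ≠ 0) : SmoothlyAssociatedAt (fun z => m z * G z) q c := by
  obtain ⟨n, hn, hn0, hG⟩ := h
  refine ⟨fun z => m z * n z, ?_, mul_ne_zero hm0 hn0, hG.mono fun z hz => by
    simp only [hz, mul_assoc]⟩
  filter_upwards [hm, hn] with z hmz hnz using hmz.mul hnz

theorem const_mul_right (h : SmoothlyAssociatedAt G q c) {a : ℂ} (ha : a ≠ 0) :
    SmoothlyAssociatedAt G (fun z => a * q z) c := by
  obtain ⟨n, hn, hn0, hG⟩ := h
  exact ⟨fun z => n z * a⁻¹, hn.mono fun z hz => hz.mul contDiffAt_const,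
    mul_ne_zero hn0 (inv_ne_zero ha), hG.mono fun z hz => by rw [hz]; field_simp⟩

theorem complexConj (h : SmoothlyAssociatedAt G q c) :
    SmoothlyAssociatedAt (fun z => conj (G z)) (fun z => conj (q z)) c := by
  obtain ⟨n, hn, hn0, hG⟩ := h
  exact ⟨fun z => conj (n z), hn.mono fun z hz => Complex.conjCLE.contDiff.contDiffAt.comp z hz,
    by simpa using hn0, hG.mono fun z hz => by simp only [hz, map_mul]⟩

theorem congr_left {G' : ℂ → ℂ} (h : SmoothlyAssociatedAt G q c) (hG : G' =ᶠ[𝓝 c] G) :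
    SmoothlyAssociatedAt G' q c := by
  obtain ⟨n, hn, hn0, hGn⟩ := h
  exact ⟨n, hn, hn0, hG.trans hGn⟩

theorem apply_eq_zero (h : SmoothlyAssociatedAt G q c) (hq : q c = 0) : G c = 0 := by
  obtain ⟨n, -, -, hG⟩ := h
  rw [hG.self_of_nhds, hq, mul_zero]

/-- If `G = n ℓ` near `c`, then `G + χ n (q - ℓ)`, with a cutoff function `χ`, does not vanish near
`c` outside of `c` because `‖χ (q - ℓ)‖ < ‖ℓ‖` there. -/
theorem exists_deformation {W : Set ℂ} (h : SmoothlyAssociatedAt G ℓ c) (hW : IsOpen W)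
    (hc : c ∈ W) (hG : ContDiffOn ℝ ∞ G W) (hG0 : ∀ z ∈ W, G z = 0 → z = c)
    (hℓ : ∀ᶠ z in 𝓝 c, ContDiffAt ℝ ∞ ℓ z) (hℓc : ℓ c = 0)
    (hq : ∀ᶠ z in 𝓝 c, ContDiffAt ℝ ∞ q z) (hqℓ : ∀ᶠ z in 𝓝[≠] c, ‖q z - ℓ z‖ < ‖ℓ z‖) :
    ∃ H : ℂ → ℂ, ContDiffOn ℝ ∞ H W ∧ (∀ z ∈ W, H z = 0 → z = c) ∧
      (∀ z, G z = 1 → H z = 1) ∧ SmoothlyAssociatedAt H q c := by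
  have hGc : G c = 0 := h.apply_eq_zero hℓc
  have hG1 : ∀ᶠ z in 𝓝 c, G z ≠ 1 :=
    (hG.continuousOn.continuousAt (hW.mem_nhds hc)).eventually_ne (by simp [hGc])
  obtain ⟨n, hn, hn0, hGn⟩ := h
  have hn0' : ∀ᶠ z in 𝓝 c, n z ≠ 0 := hn.self_of_nhds.continuousAt.eventually_ne hn0
  obtain ⟨ρ, hρ, hball⟩ := Metric.eventually_nhds_iff_ball.1
    (hGn.and (hG1.and ((eventually_nhdsWithin_iff.1 hqℓ).and (hn0'.and (hn.and (hq.and hℓ))))))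
  let χ : ContDiffBump c := ⟨ρ / 4, ρ / 2, by positivity, by linarith⟩
  have hχ0 (z : ℂ) (hz : z ∉ ball c ρ) : χ z = 0 :=
    χ.zero_of_le_dist ((half_le_self hρ.le).trans (by simpa using hz))
  have hχsupp : tsupport χ ⊆ ball c ρ :=
    χ.tsupport_eq ▸ closedBall_subset_ball (half_lt_self hρ)
  have hbump : ContDiff ℝ ∞ fun z => χ z • (n z * (q z - ℓ z)) := by
    refine contDiff_smul_of_tsupport_subset χ.contDiff hχsupp isOpen_ball fun z hz => ?_
    obtain ⟨-, -, -, -, hnz, hqz, hℓz⟩ := hball z hz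
    exact (hnz.mul (hqz.sub hℓz)).contDiffWithinAt
  refine ⟨fun z => G z + χ z • (n z * (q z - ℓ z)), hG.add hbump.contDiffOn, fun z hz h0 => ?_,
    fun z hz => ?_, n, hn, hn0, ?_⟩
  · by_cases hzρ : z ∈ ball c ρ
    · obtain ⟨hGz, -, hlt, hnz, -⟩ := hball z hzρ
      by_contra hzc
      exact mul_add_smul_mul_sub_ne_zero hnz (χ.nonneg' z) χ.le_one (hlt hzc) (hGz ▸ h0)
    · exact hG0 z hz (by simpa [hχ0 z hzρ] using h0)
  · have hzρ : z ∉ ball c ρ := fun hzρ => (hball z hzρ).2.1 hz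
    simp only [hχ0 z hzρ, zero_smul, add_zero, hz]
  · filter_upwards [hGn, χ.eventuallyEq_one] with z hGz hχz
    rw [hGz, hχz, Pi.one_apply, one_smul]
    ring

end SmoothlyAssociatedAt

end SmoothlyAssociatedAt

section SmoothFactor

open Filter Topology

variable {W : Set ℂ} {c : ℂ} {u q : ℂ → ℂ}

theorem exists_smooth_elementary_factor : ∃ E : ℂ → ℂ, ContDiff ℝ ∞ E ∧ (∀ w, E w = 0 → w = 1) ∧
    (∀ w, ‖w‖ < 1 / 4 → E w = 1) ∧ ∀ᶠ w in 𝓝 1, E w = 1 - w := by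
  let χ : ContDiffBump (0 : ℂ) := ⟨1 / 4, 1 / 2, by norm_num, by norm_num⟩
  have hχ0 (w : ℂ) (hw : 1 / 2 ≤ ‖w‖) : χ w = 0 :=
    χ.zero_of_le_dist (by rw [dist_zero_right]; exact hw)
  refine ⟨fun w => 1 - (1 - χ w) • w, ?_, fun w hw => ?_, fun w hw => ?_, ?_⟩
  · exact contDiff_const.sub ((contDiff_const.sub χ.contDiff).smul contDiff_id)
  · have hmul : (1 - χ w) • w = 1 := (sub_eq_zero.1 hw).symm
    have hw1 : 1 ≤ ‖w‖ := by
      rw [← norm_one (α := ℂ), ← hmul, norm_smul,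
        Real.norm_of_nonneg (sub_nonneg.2 χ.le_one)]
      exact mul_le_of_le_one_left (norm_nonneg w) (by linarith [χ.nonneg (x := w)])
    simpa [hχ0 w (by linarith)] using hmul
  · have hχ1 : χ w = 1 := χ.one_of_mem_closedBall
      (by rw [mem_closedBall_zero_iff]; exact hw.le)
    simp [hχ1]
  · have hlarge : ∀ᶠ w : ℂ in 𝓝 1, 1 / 2 ≤ ‖w‖ :=
      continuous_norm.continuousAt.eventually (le_mem_nhds (by norm_num))
    filter_upwards [hlarge] with w hw
    simp [hχ0 w hw]

theorem IsMobiusCoordinate.exists_smooth_linear_factor (hu : IsMobiusCoordinate W c u)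
    (hW : IsOpen W) (hc : c ∈ W) :
    ∃ G : ℂ → ℂ, ContDiffOn ℝ ∞ G W ∧ (∀ z ∈ W, G z = 0 → z = c) ∧
      (∀ z, ‖u z‖ < 1 / 4 → G z = 1) ∧ SmoothlyAssociatedAt G (fun z => z - c) c := by
  obtain ⟨E, hE, hE0, hE1, hE'⟩ := exists_smooth_elementary_factor
  obtain ⟨κ, γ, hκ, hγ, hγ0, hsub, -⟩ := hu.exists_sub_eq
  have hucont : ContinuousAt u c := hu.differentiableOn.continuousOn.continuousAt (hW.mem_nhds hc)
  refine ⟨fun z => E (u z),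
    hE.comp_contDiffOn ((hu.differentiableOn.contDiffOn hW).restrict_scalars ℝ),
    fun z hz h => ?_, fun z hz => hE1 _ hz, fun z => -κ * γ z * γ c, ?_, ?_, ?_⟩
  · have h0 : κ * γ z * γ c * (z - c) = 0 := by rw [← hsub z hz c hc, hE0 _ h, hu.1, sub_self]
    simpa [hκ, hγ0 z hz, hγ0 c hc, sub_eq_zero] using h0
  · filter_upwards [hW.mem_nhds hc] with z hz
    have := ((hγ.contDiffOn hW).contDiffAt (hW.mem_nhds hz)).restrict_scalars (n := ∞) ℝ
    fun_prop
  · simp [hκ, hγ0 c hc]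
  · have hEu : ∀ᶠ w in 𝓝 (u c), E w = 1 - w := by rwa [hu.1]
    filter_upwards [hucont.eventually hEu, hW.mem_nhds hc] with z hz hzW
    rw [hz]
    linear_combination -hsub z hzW c hc - hu.1

theorem eventually_norm_sub_lt_norm_of_fderiv (hq : DifferentiableAt ℝ q c) (hqc : q c = 0)
    {ℓ : ℂ → ℂ} {α β : ℝ} (hαβ : β < α) (hℓ : ∀ z, ‖ℓ z‖ = α * ‖z - c‖)
    (hqℓ : ∀ z, ‖fderiv ℝ q c (z - c) - ℓ z‖ = β * ‖z - c‖) :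
    ∀ᶠ z in 𝓝[≠] c, ‖q z - ℓ z‖ < ‖ℓ z‖ := by
  rw [eventually_nhdsWithin_iff]
  filter_upwards [hq.hasFDerivAt.isLittleO.def (c := (α - β) / 2) (by linarith)] with z hz hzc
  rw [hqc, sub_zero] at hz
  have hpos : 0 < ‖z - c‖ := norm_pos_iff.2 (sub_ne_zero.2 hzc)
  calc ‖q z - ℓ z‖
      ≤ ‖q z - fderiv ℝ q c (z - c)‖ + ‖fderiv ℝ q c (z - c) - ℓ z‖ :=
        norm_sub_le_norm_sub_add_norm_sub _ _ _
    _ ≤ (α - β) / 2 * ‖z - c‖ + β * ‖z - c‖ := by rw [hqℓ]; gcongr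
    _ < ‖ℓ z‖ := by rw [hℓ]; nlinarith

/-- The differential of `q` at `c` is `v ↦ ∂q v + ∂̄q v̄`. Its determinant is `|∂q|² - |∂̄q|²`, so
one of the two terms dominates, and `q` is a perturbation of a multiple of `z - c` or of its
conjugate. -/
theorem IsMobiusCoordinate.exists_smooth_factor (hu : IsMobiusCoordinate W c u) (hW : IsOpen W)
    (hc : c ∈ W) (hq : ∀ᶠ z in 𝓝 c, ContDiffAt ℝ ∞ q z) (hqc : q c = 0)
    (hdet : (fderiv ℝ q c).det ≠ 0) :
    ∃ G : ℂ → ℂ, ContDiffOn ℝ ∞ G W ∧ (∀ z ∈ W, G z = 0 → z = c) ∧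
      (∀ z, ‖u z‖ < 1 / 4 → G z = 1) ∧ SmoothlyAssociatedAt G q c := by
  obtain ⟨G, hG, hG0, hG1, hGc⟩ := hu.exists_smooth_linear_factor hW hc
  have hd : DifferentiableAt ℝ q c := hq.self_of_nhds.differentiableAt (by simp)
  have hne : ‖wirtingerD q c‖ ≠ ‖wirtingerDbar q c‖ := fun h =>
    hdet (by rw [det_fderiv_eq_wirtinger, h, sub_self])
  rcases hne.lt_or_gt with hlt | hlt
  · have h0 : wirtingerDbar q c ≠ 0 := norm_pos_iff.1 ((norm_nonneg _).trans_lt hlt)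
    obtain ⟨H, hH, hH0, hH1, hHq⟩ := (hGc.complexConj.const_mul_right h0).exists_deformation hW hc
      (contDiffOn_conj hG) (fun z hz h => hG0 z hz (by simpa using h))
      (Eventually.of_forall fun z => contDiffAt_const.mul
        (Complex.conjCLE.contDiff.contDiffAt.comp z (contDiffAt_id.sub contDiffAt_const)))
      (by simp) hq (eventually_norm_sub_lt_norm_of_fderiv hd hqc hlt
        (fun z => by rw [norm_mul, RCLike.norm_conj]) fun z => by
          rw [fderiv_apply_eq_wirtinger, add_sub_cancel_right, norm_mul])
    exact ⟨H, hH, hH0, fun z hz => hH1 z (by rw [hG1 z hz, map_one]), hHq⟩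
  · have h0 : wirtingerD q c ≠ 0 := norm_pos_iff.1 ((norm_nonneg _).trans_lt hlt)
    obtain ⟨H, hH, hH0, hH1, hHq⟩ := (hGc.const_mul_right h0).exists_deformation hW hc hG hG0
      (Eventually.of_forall fun z => by fun_prop)
      (by simp) hq (eventually_norm_sub_lt_norm_of_fderiv hd hqc hlt
        (fun z => norm_mul _ _) fun z => by
          rw [fderiv_apply_eq_wirtinger, add_sub_cancel_left, norm_mul, RCLike.norm_conj])
    exact ⟨H, hH, hH0, fun z hz => hH1 z (hG1 z hz), hHq⟩

theorem exists_smooth_weierstrass_product (hW : IsOpen W) {Z : Set ℂ} (hZW : Z ⊆ W)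
    (hZ : ∀ K ⊆ W, IsCompact K → (Z ∩ K).Finite)
    (hq : ∀ c ∈ Z, ∀ᶠ z in 𝓝 c, ContDiffAt ℝ ∞ q z) (hq0 : ∀ c ∈ Z, q c = 0)
    (hdet : ∀ c ∈ Z, (fderiv ℝ q c).det ≠ 0) :
    ∃ G : ℂ → ℂ, ContDiffOn ℝ ∞ G W ∧ (∀ z ∈ W, G z = 0 → z ∈ Z) ∧
      ∀ c ∈ Z, SmoothlyAssociatedAt G q c := by
  classical
  obtain ⟨u, hu, hfar⟩ := exists_isMobiusCoordinate_family hW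
  choose G hG hG0 hG1 hGq using fun c : Z => (hu c (hZW c.2)).exists_smooth_factor hW (hZW c.2)
    (hq c c.2) (hq0 c c.2) (hdet c c.2)
  have hfin : LocallyFiniteOn (fun c => Function.mulSupport (G c)) W := fun ⟨z₀, hz₀⟩ => by
    obtain ⟨N, hN, -, K, hKW, hK, hsmall⟩ := hfar z₀ hz₀
    refine ⟨_, preimage_coe_mem_nhds_subtype.2 (mem_nhdsWithin_of_mem_nhds hN),
      ((hZ K hKW hK).preimage Subtype.val_injective.injOn).subset ?_⟩
    rintro c ⟨z, hz, hzN⟩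
    by_contra hcK
    exact hz (hG1 c z (hsmall c ⟨hZW c.2, fun h => hcK ⟨c.2, h⟩⟩ z hzN))
  refine ⟨fun z => ∏ᶠ c, G c z, fun z hz => ?_, fun z hz h0 => ?_, fun c hc => ?_⟩
  · obtain ⟨F, -, hF⟩ := hfin.exists_finset_finprod_eq hW hz
    have hprod : ContDiffAt ℝ ∞ (fun w => ∏ c ∈ F, G c w) z :=
      contDiffAt_prod fun c _ => (hG c).contDiffAt (hW.mem_nhds hz)
    exact (hprod.congr_of_eventuallyEq hF).contDiffWithinAt
  · obtain ⟨F, -, hF⟩ := hfin.exists_finset_finprod_eq hW hz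
    beta_reduce at h0
    rw [hF.self_of_nhds, Finset.prod_eq_zero_iff] at h0
    obtain ⟨c, -, hcz⟩ := h0
    exact hG0 c z hz hcz ▸ c.2
  · obtain ⟨F, hF1, hF⟩ := hfin.exists_finset_finprod_eq hW (hZW hc)
    have hcF : ⟨c, hc⟩ ∈ F := by
      by_contra hcF
      exact zero_ne_one (((hGq ⟨c, hc⟩).apply_eq_zero (hq0 c hc)).symm.trans (hF1 _ hcF))
    refine ((hGq ⟨c, hc⟩).mul_left (m := fun z => ∏ c' ∈ F.erase ⟨c, hc⟩, G c' z) ?_ ?_).congr_left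
      (hF.mono fun z hz => by
        simp only [hz, Finset.prod_erase_mul _ _ hcF])
    · filter_upwards [hW.mem_nhds (hZW hc)] with z hz
      exact contDiffAt_prod fun c' _ => (hG c').contDiffAt (hW.mem_nhds hz)
    · refine Finset.prod_ne_zero_iff.2 fun c' hc' h => Finset.ne_of_mem_erase hc' (Subtype.ext ?_)
      exact (hG0 c' c (hZW hc) h).symm

end SmoothFactor

/-! ### Nowhere vanishing generators of families of lines -/

section Generator

open Set Topology MeasureTheory

variable {E : Type*} [NormedAddCommGroup E] [InnerProductSpace ℂ E]
  {W : Set ℂ} {p q v : ℂ → E} {c : ℂ}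

theorem exists_contDiffOn_eq_smul (hp : ContDiffOn ℝ ∞ p W) (hv : ContDiffOn ℝ ∞ v W)
    (hv0 : ∀ z ∈ W, v z ≠ 0) (hpv : ∀ z ∈ W, p z ∈ Submodule.span ℂ {v z}) :
    ∃ α : ℂ → ℂ, ContDiffOn ℝ ∞ α W ∧ ∀ z ∈ W, p z = α z • v z := by
  have hvv : ∀ z ∈ W, inner ℂ (v z) (v z) ≠ 0 := fun z hz => inner_self_ne_zero.2 (hv0 z hz)
  refine ⟨fun z => inner ℂ (v z) (p z) * (inner ℂ (v z) (v z))⁻¹,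
    (hv.inner ℂ hp).mul ((hv.inner ℂ hv).inv hvv), fun z hz => ?_⟩
  obtain ⟨a, ha⟩ := Submodule.mem_span_singleton.1 (hpv z hz)
  simp only [← ha, inner_smul_right, mul_inv_cancel_right₀ (hvv z hz)]

theorem exists_smooth_of_isolated_quotients {F : Type*} [NormedAddCommGroup F] [NormedSpace ℂ F]
    [NormedSpace ℝ F] {G : ℂ → ℂ} {s : ℂ → F} (hW : IsOpen W)
    (hG : ∀ c ∈ W, ∀ᶠ z in 𝓝[≠] c, G z ≠ 0) {L : ℂ → F → Prop}
    (h : ∀ c ∈ W, ∃ n : ℂ → F, ContDiffAt ℝ ∞ n c ∧ L c (n c) ∧ ∀ᶠ z in 𝓝 c, s z = G z • n z) :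
    ∃ v : ℂ → F, ContDiffOn ℝ ∞ v W ∧ ∀ z ∈ W, L z (v z) := by
  choose! n hn hL hs using h
  refine ⟨fun z => n z z, fun c hc => ?_, hL⟩
  have heq : ∀ᶠ z in 𝓝 c, n z z = n c z := by
    filter_upwards [eventually_nhdsWithin_iff.1 (hG c hc), hs c hc, hW.mem_nhds hc]
      with z hGz hsz hz
    rcases eq_or_ne z c with rfl | hzc
    · rfl
    · exact smul_right_injective F (hGz hzc) ((hs z hz).self_of_nhds.symm.trans hsz)
  exact ((hn c hc).congr_of_eventuallyEq heq).contDiffWithinAt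

theorem finite_inter_of_eventually_notMem {X : Type*} [TopologicalSpace X] {Z K : Set X}
    (hK : IsCompact K) (hZ : ∀ c ∈ K, ∀ᶠ z in 𝓝[≠] c, z ∉ Z) : (Z ∩ K).Finite := by
  refine hK.induction_on (p := fun S => (Z ∩ S).Finite) (by simp)
    (fun S T hST hT => hT.subset (inter_subset_inter_right Z hST))
    (fun S T hS hT => by rw [inter_union_distrib_left]; exact hS.union hT) fun c hc =>
    ⟨_, mem_nhdsWithin_of_mem_nhds (eventually_nhdsWithin_iff.1 (hZ c hc)),
      (finite_singleton c).subset fun z hz => ?_⟩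
  by_contra hzc
  exact hz.2 hzc hz.1

theorem exists_regular_value {τ : ℂ → ℂ} {O : Set ℂ} (hτ : ∀ z ∈ O, DifferentiableAt ℝ τ z) :
    ∃ t, ∀ z ∈ O, τ z = t → (fderiv ℝ τ z).det ≠ 0 := by
  by_contra! h
  have hnull := addHaar_image_eq_zero_of_det_fderivWithin_eq_zero (volume : Measure ℂ)
    (s := {z ∈ O | (fderiv ℝ τ z).det = 0}) (f := τ) (f' := fderiv ℝ τ)
    (fun z hz => (hτ z hz.1).hasFDerivAt.hasFDerivWithinAt) fun z hz => hz.2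
  have huniv : τ '' {z ∈ O | (fderiv ℝ τ z).det = 0} = univ :=
    eq_univ_of_forall fun t => let ⟨z, hz, hzt, hdet⟩ := h t; ⟨z, ⟨hz, hdet⟩, hzt⟩
  rw [huniv] at hnull
  exact Measure.measure_univ_ne_zero.2 (NeZero.ne _) hnull

theorem mem_span_sub_smul_of_not_linearIndependent {K F : Type*} [Field K] [AddCommGroup F]
    [Module K F] {x y : F} {t : K} (h : ¬ LinearIndependent K ![x, y]) (hxy : x - t • y ≠ 0) :
    x ∈ Submodule.span K {x - t • y} ∧ y ∈ Submodule.span K {x - t • y} := by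
  rw [← LinearIndependent.pair_add_smul_left_iff (-t), neg_smul, ← sub_eq_add_neg,
    LinearIndependent.pair_iff' hxy] at h
  have hy : y ∈ Submodule.span K {x - t • y} :=
    Submodule.mem_span_singleton.2 (by simpa using h)
  refine ⟨?_, hy⟩
  simpa using add_mem (Submodule.mem_span_singleton_self (x - t • y)) (Submodule.smul_mem _ t hy)

/-- Where `q` does not vanish, `p = τ q`; the parameter `t` is a regular value of `τ`. -/
theorem exists_regular_combination (hW : IsOpen W) (hp : ContDiffOn ℝ ∞ p W)
    (hq : ContDiffOn ℝ ∞ q W) (hdep : ∀ z ∈ W, ¬ LinearIndependent ℂ ![p z, q z])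
    (hne : ∀ z ∈ W, p z ≠ 0 ∨ q z ≠ 0) :
    ∃ (t : ℂ) (τ : ℂ → ℂ), ∀ c ∈ W, p c - t • q c = 0 →
      q c ≠ 0 ∧ (∀ᶠ z in 𝓝 c, ContDiffAt ℝ ∞ τ z) ∧ τ c = 0 ∧ (fderiv ℝ τ c).det ≠ 0 ∧
        ∀ᶠ z in 𝓝 c, p z - t • q z = τ z • q z := by
  let O : Set ℂ := W ∩ q ⁻¹' {0}ᶜ
  have hO : IsOpen O := hq.continuousOn.isOpen_inter_preimage hW isOpen_compl_singleton
  obtain ⟨τ, hτ, hpτ⟩ := exists_contDiffOn_eq_smul (hp.mono inter_subset_left)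
    (hq.mono inter_subset_left) (fun z (hz : z ∈ O) => hz.2) fun z hz => by
      have hqp := hdep z hz.1
      rw [LinearIndependent.pair_symm_iff, LinearIndependent.pair_iff' hz.2] at hqp
      exact Submodule.mem_span_singleton.2 (by simpa using hqp)
  have hτO {z : ℂ} (hz : z ∈ O) : ContDiffAt ℝ ∞ τ z := hτ.contDiffAt (hO.mem_nhds hz)
  obtain ⟨t, ht⟩ := exists_regular_value fun z hz => (hτO hz).differentiableAt (by simp)
  refine ⟨t, fun z => τ z - t, fun c hc hpq => ?_⟩
  have hqc : q c ≠ 0 := fun h => (hne c hc).elim (fun hpc => hpc (by simpa [h] using hpq)) (· h)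
  have hτc : τ c - t = 0 := by
    rw [hpτ c ⟨hc, hqc⟩, ← sub_smul] at hpq
    exact (smul_eq_zero.1 hpq).resolve_right hqc
  refine ⟨hqc, ?_, hτc, ?_, ?_⟩
  · filter_upwards [hO.mem_nhds ⟨hc, hqc⟩] with z hz using (hτO hz).sub contDiffAt_const
  · rw [fderiv_sub_const]
    exact ht c ⟨hc, hqc⟩ (sub_eq_zero.1 hτc)
  · filter_upwards [hO.mem_nhds ⟨hc, hqc⟩] with z hz
    rw [hpτ z hz, sub_smul]

theorem eventually_ne_zero_of_eq_smul {F : Type*} [NormedAddCommGroup F] [NormedSpace ℂ F]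
    {τ : ℂ → ℂ} {q s : ℂ → F} (hdet : (fderiv ℝ τ c).det ≠ 0) (hq : ContinuousAt q c)
    (hqc : q c ≠ 0) (hs : ∀ᶠ z in 𝓝 c, s z = τ z • q z) : ∀ᶠ z in 𝓝[≠] c, s z ≠ 0 := by
  have hτ : DifferentiableAt ℝ τ c := by
    by_contra h
    simp [fderiv_zero_of_not_differentiableAt h, ContinuousLinearMap.det] at hdet
  have hτ0 : ∀ᶠ z in 𝓝[≠] c, τ z ≠ 0 := hτ.hasFDerivAt.eventually_ne
    ⟨_, ((fderiv ℝ τ c).toContinuousLinearEquivOfDetNeZero hdet).antilipschitz⟩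
  filter_upwards [hτ0, nhdsWithin_le_nhds hs, nhdsWithin_le_nhds (hq.eventually_ne hqc)]
    with z hτz hsz hqz
  exact hsz ▸ smul_ne_zero hτz hqz

theorem SmoothlyAssociatedAt.exists_smul_quotient {F : Type*} [NormedAddCommGroup F]
    [NormedSpace ℂ F] [NormedSpace ℝ F] [IsScalarTower ℝ ℂ F] {G τ : ℂ → ℂ} {q s : ℂ → F}
    (hG : SmoothlyAssociatedAt G τ c) (hq : ContDiffAt ℝ ∞ q c)
    (hs : ∀ᶠ z in 𝓝 c, s z = τ z • q z) :
    ∃ n : ℂ → F, ContDiffAt ℝ ∞ n c ∧ Submodule.span ℂ {n c} = Submodule.span ℂ {q c} ∧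
      ∀ᶠ z in 𝓝 c, s z = G z • n z := by
  obtain ⟨m, hm, hm0, hGm⟩ := hG
  refine ⟨fun z => (m z)⁻¹ • q z, (hm.self_of_nhds.inv hm0).smul hq,
    Submodule.span_singleton_smul_eq (inv_ne_zero hm0).isUnit _, ?_⟩
  filter_upwards [hGm, hs, hm.self_of_nhds.continuousAt.eventually_ne hm0] with z hGz hsz hmz
  rw [hGz, hsz, smul_smul, mul_right_comm, mul_inv_cancel₀ hmz, one_mul]

theorem exists_smooth_generator [IsScalarTower ℝ ℂ E] (hW : IsOpen W) (hp : ContDiffOn ℝ ∞ p W)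
    (hq : ContDiffOn ℝ ∞ q W) (hdep : ∀ z ∈ W, ¬ LinearIndependent ℂ ![p z, q z])
    (hne : ∀ z ∈ W, p z ≠ 0 ∨ q z ≠ 0) :
    ∃ v : ℂ → E, ContDiffOn ℝ ∞ v W ∧
      ∀ z ∈ W, p z ∈ Submodule.span ℂ {v z} ∧ q z ∈ Submodule.span ℂ {v z} := by
  obtain ⟨t, τ, hτ⟩ := exists_regular_combination hW hp hq hdep hne
  let s : ℂ → E := fun z => p z - t • q z
  let Z : Set ℂ := {z ∈ W | s z = 0}
  have hs : ContDiffOn ℝ ∞ s W := hp.sub (contDiffOn_const.smul hq)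
  have hqc {c : ℂ} (hc : c ∈ W) : ContDiffAt ℝ ∞ q c := hq.contDiffAt (hW.mem_nhds hc)
  have hisol : ∀ c ∈ W, ∀ᶠ z in 𝓝[≠] c, s z ≠ 0 := fun c hc => by
    by_cases hsc : s c = 0
    · obtain ⟨hqc0, -, -, hdet, hsτ⟩ := hτ c hc hsc
      exact eventually_ne_zero_of_eq_smul hdet (hqc hc).continuousAt hqc0 hsτ
    · exact nhdsWithin_le_nhds
        ((hs.continuousOn.continuousAt (hW.mem_nhds hc)).eventually_ne hsc)
  obtain ⟨G, hG, hG0, hGτ⟩ := exists_smooth_weierstrass_product (q := τ) hW (Z := Z)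
    (fun z hz => hz.1) (fun K hKW hK => finite_inter_of_eventually_notMem hK fun c hc =>
      (hisol c (hKW hc)).mono fun z hsz hz => hsz hz.2) (fun c hc => (hτ c hc.1 hc.2).2.1)
    (fun c hc => (hτ c hc.1 hc.2).2.2.1) fun c hc => (hτ c hc.1 hc.2).2.2.2.1
  refine exists_smooth_of_isolated_quotients (s := s) (G := G)
    (L := fun z x => p z ∈ Submodule.span ℂ {x} ∧ q z ∈ Submodule.span ℂ {x}) hW
    (fun c hc => ?_) fun c hc => ?_
  · filter_upwards [hisol c hc, nhdsWithin_le_nhds (hW.mem_nhds hc)] with z hsz hz hGz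
    exact hsz (hG0 z hz hGz).2
  by_cases hcZ : c ∈ Z
  · obtain ⟨n, hn, hspan, hsn⟩ := (hGτ c hcZ).exists_smul_quotient (hqc hc) (hτ c hc hcZ.2).2.2.2.2
    have hmem : q c ∈ Submodule.span ℂ {n c} := hspan ▸ Submodule.mem_span_singleton_self _
    exact ⟨n, hn, ⟨sub_eq_zero.1 hcZ.2 ▸ Submodule.smul_mem _ t hmem, hmem⟩, hsn⟩
  · have hGc : G c ≠ 0 := mt (hG0 c hc) hcZ
    refine ⟨fun z => (G z)⁻¹ • s z, ((hG.contDiffAt (hW.mem_nhds hc)).inv hGc).smul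
      (hs.contDiffAt (hW.mem_nhds hc)), ?_, ?_⟩
    · rw [Submodule.span_singleton_smul_eq (inv_ne_zero hGc).isUnit]
      exact mem_span_sub_smul_of_not_linearIndependent (hdep c hc) fun h => hcZ ⟨hc, h⟩
    · filter_upwards [(hG.continuousOn.continuousAt (hW.mem_nhds hc)).eventually_ne hGc] with z hGz
      exact (smul_inv_smul₀ hGz _).symm

end Generator

/-! ### Existence of Weierstrass representations -/

section SpinorMatrix

variable {W : Set ℂ} {z : ℂ}

/-- The matrix of a vector of `ℂ⁴` under the spinor identification of `ℂ⁴` with the `2 × 2`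
matrices, which turns the quadratic form `∑ k, f k ^ 2` into minus the determinant. It is chosen so
that the Weierstrass formulas say that the matrix of the coefficients is a product of spinors. -/
def spinorMatrix (f : Fin 4 → ℂ) : Matrix (Fin 2) (Fin 2) ℂ :=
  !![f 1 - Complex.I * f 0, f 2 - Complex.I * f 3;
    f 2 + Complex.I * f 3, -f 1 - Complex.I * f 0]

theorem det_spinorMatrix (f : Fin 4 → ℂ) : (spinorMatrix f).det = -∑ k, f k ^ 2 := by
  rw [spinorMatrix, Matrix.det_fin_two_of, Fin.sum_univ_four]
  linear_combination (f 0 ^ 2 + f 3 ^ 2) * Complex.I_sq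

theorem spinorMatrix_injective : Function.Injective spinorMatrix := by
  intro f g hfg
  have h00 := congrFun₂ hfg 0 0
  have h01 := congrFun₂ hfg 0 1
  have h10 := congrFun₂ hfg 1 0
  have h11 := congrFun₂ hfg 1 1
  simp only [spinorMatrix, Matrix.of_apply, Matrix.cons_val_zero, Matrix.cons_val_one,
    Matrix.cons_val', Matrix.cons_val_fin_one] at h00 h01 h10 h11
  ext k
  fin_cases k <;> simp only [Fin.zero_eta, Fin.mk_one, Fin.reduceFinMk]
  · linear_combination Complex.I / 2 * (h00 + h11) + (f 0 - g 0) * Complex.I_sq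
  · linear_combination (h00 - h11) / 2
  · linear_combination (h01 + h10) / 2
  · linear_combination Complex.I / 2 * (h01 - h10) + (f 3 - g 3) * Complex.I_sq

theorem spinorMatrix_zero : spinorMatrix 0 = 0 := by
  ext i j
  fin_cases i <;> fin_cases j <;> simp [spinorMatrix]

theorem spinorMatrix_of_conj_eq_self {f : Fin 4 → ℂ} (hf : ∀ k, conj (f k) = f k) :
    spinorMatrix f 1 1 = -conj (spinorMatrix f 0 0) ∧
      spinorMatrix f 1 0 = conj (spinorMatrix f 0 1) := by
  simp [spinorMatrix, hf, add_comm, sub_eq_add_neg]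

theorem contDiffOn_spinorMatrix {f : ℂ → Fin 4 → ℂ}
    (hf : ∀ k, ContDiffOn ℝ ∞ (fun w => f w k) W) (i j : Fin 2) :
    ContDiffOn ℝ ∞ (fun w => spinorMatrix (f w) i j) W := by
  fin_cases i <;> fin_cases j
  · exact (hf 1).sub (contDiffOn_const.mul (hf 0))
  · exact (hf 2).sub (contDiffOn_const.mul (hf 3))
  · exact (hf 2).add (contDiffOn_const.mul (hf 3))
  · exact (hf 1).neg.sub (contDiffOn_const.mul (hf 0))

theorem wirtingerDbar_spinorMatrix {f : ℂ → Fin 4 → ℂ}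
    (hf : ∀ k, DifferentiableAt ℝ (fun w => f w k) z) (i j : Fin 2) :
    wirtingerDbar (fun w => spinorMatrix (f w) i j) z =
      spinorMatrix (fun k => wirtingerDbar (fun w => f w k) z) i j := by
  have linear (a b : ℂ) (k l : Fin 4) : wirtingerDbar (fun w => a * f w k + b * f w l) z =
      a * wirtingerDbar (fun w => f w k) z + b * wirtingerDbar (fun w => f w l) z := by
    rw [wirtingerDbar_add ((hf k).const_mul a) ((hf l).const_mul b),
      wirtingerDbar_const_mul a (hf k), wirtingerDbar_const_mul b (hf l)]
  fin_cases i <;> fin_cases j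
  · simpa [spinorMatrix, sub_eq_add_neg] using linear 1 (-Complex.I) 1 0
  · simpa [spinorMatrix, sub_eq_add_neg] using linear 1 (-Complex.I) 2 3
  · simpa [spinorMatrix] using linear 1 Complex.I 2 3
  · simpa [spinorMatrix, sub_eq_add_neg] using linear (-1) (-Complex.I) 1 0

theorem WeierstrassData.spinorMatrix_coeff (R : WeierstrassData) (z : ℂ) :
    spinorMatrix (R.coeff z) =
      Matrix.vecMulVec ![conj (R.φ₂ z), R.φ₁ z] ![conj (R.ψ₂ z), R.ψ₁ z] := by
  ext i j
  fin_cases i <;> fin_cases j <;>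
    simp [spinorMatrix, WeierstrassData.coeff, Matrix.vecMulVec_apply] <;> ring_nf <;>
    simp only [Complex.I_sq] <;> ring

end SpinorMatrix

section Frame

variable {W : Set ℂ} {z : ℂ}

open scoped ComplexOrder in
theorem sum_conj_mul_self_ne_zero {ι : Type*} [Fintype ι] {v : ι → ℂ} (hv : v ≠ 0) :
    ∑ i, conj (v i) * v i ≠ 0 :=
  mt dotProduct_star_self_eq_zero.1 hv

theorem not_linearIndependent_row_of_det_eq_zero {M : Matrix (Fin 2) (Fin 2) ℂ} (hM : M.det = 0) :
    ¬ LinearIndependent ℂ ![WithLp.toLp 2 (M 0), WithLp.toLp 2 (M 1)] := by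
  intro h
  have hrow : LinearIndependent ℂ M.row := by
    convert! h.map' (WithLp.linearEquiv 2 ℂ (Fin 2 → ℂ)).toLinearMap (LinearEquiv.ker _) using 1
    ext i j
    fin_cases i <;> rfl
  rw [Matrix.linearIndependent_rows_iff_isUnit, Matrix.isUnit_iff_isUnit_det, hM] at hrow
  exact not_isUnit_zero hrow

theorem exists_smooth_rank_one_factorization {M : ℂ → Matrix (Fin 2) (Fin 2) ℂ} (hW : IsOpen W)
    (hM : ∀ i j, ContDiffOn ℝ ∞ (fun z => M z i j) W) (hdet : ∀ z ∈ W, (M z).det = 0)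
    (hM0 : ∀ z ∈ W, M z ≠ 0) :
    ∃ u v : Fin 2 → ℂ → ℂ, (∀ i, ContDiffOn ℝ ∞ (u i) W) ∧ (∀ i, ContDiffOn ℝ ∞ (v i) W) ∧
      ∀ z ∈ W, M z = Matrix.vecMulVec (u · z) (v · z) := by
  let row (i : Fin 2) (z : ℂ) : EuclideanSpace ℂ (Fin 2) := WithLp.toLp 2 (M z i)
  have hrow (i : Fin 2) : ContDiffOn ℝ ∞ (row i) W := (contDiffOn_piLp 2).2 (hM i)
  have hrow0 (z : ℂ) (hz : z ∈ W) : row 0 z ≠ 0 ∨ row 1 z ≠ 0 := by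
    contrapose! hM0
    refine ⟨z, hz, ?_⟩
    ext i j
    fin_cases i
    · exact congrArg (· j) hM0.1
    · exact congrArg (· j) hM0.2
  obtain ⟨v, hv, hspan⟩ := exists_smooth_generator hW (hrow 0) (hrow 1)
    (fun z hz => not_linearIndependent_row_of_det_eq_zero (hdet z hz)) hrow0
  have hmem (i : Fin 2) (z : ℂ) (hz : z ∈ W) : row i z ∈ Submodule.span ℂ {v z} := by
    fin_cases i
    · exact (hspan z hz).1
    · exact (hspan z hz).2
  have hv0 (z : ℂ) (hz : z ∈ W) : v z ≠ 0 := fun h => by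
    have hz0 := hspan z hz
    rw [h, Submodule.span_zero_singleton, Submodule.mem_bot, Submodule.mem_bot] at hz0
    exact (hrow0 z hz).elim (· hz0.1) (· hz0.2)
  choose u hu hrowu using fun i => exists_contDiffOn_eq_smul (hrow i) hv hv0 (hmem i)
  exact ⟨u, fun i z => v z i, hu, (contDiffOn_piLp 2).1 hv, fun z hz => Matrix.ext fun i j =>
    congrArg (· j) (hrowu i z hz)⟩

theorem exists_cexp_mul_orthogonal_wirtingerDbar {ι : Type*} [Fintype ι] {v : ι → ℂ → ℂ}
    (hW : IsOpen W) (hv : ∀ i, ContDiffOn ℝ ∞ (v i) W) (hv0 : ∀ z ∈ W, (v · z) ≠ 0) :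
    ∃ h : ℂ → ℂ, ContDiffOn ℝ ∞ h W ∧ ∀ z ∈ W, ∑ i, conj (Complex.exp (h z) * v i z) *
      wirtingerDbar (fun w => Complex.exp (h w) * v i w) z = 0 := by
  have hvv (z : ℂ) (hz : z ∈ W) := sum_conj_mul_self_ne_zero (hv0 z hz)
  have hconj (i : ι) := contDiffOn_conj (hv i)
  obtain ⟨h, hh, hdbar⟩ := exists_wirtingerDbar_eq hW
    (g := fun z => -(∑ i, conj (v i z) * wirtingerDbar (v i) z) * (∑ i, conj (v i z) * v i z)⁻¹)
    ((ContDiffOn.sum fun i _ =>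
      (hconj i).mul (contDiffOn_wirtingerDbar (hv i) hW (by simp))).neg.mul
        ((ContDiffOn.sum fun i _ => (hconj i).mul (hv i)).inv hvv))
  refine ⟨h, hh, fun z hz => ?_⟩
  have hhz := differentiableAt_of_contDiffOn hh hW hz
  have hterm (i : ι) : conj (Complex.exp (h z) * v i z) *
      wirtingerDbar (fun w => Complex.exp (h w) * v i w) z =
      conj (Complex.exp (h z)) * Complex.exp (h z) *
        (wirtingerDbar h z * (conj (v i z) * v i z) + conj (v i z) * wirtingerDbar (v i) z) := by
    rw [wirtingerDbar_mul hhz.cexp (differentiableAt_of_contDiffOn (hv i) hW hz),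
      wirtingerDbar_cexp hhz, map_mul]
    ring
  simp only [hterm, ← Finset.mul_sum, Finset.sum_add_distrib, hdbar z hz]
  rw [inv_mul_cancel_right₀ (hvv z hz), neg_add_cancel, mul_zero]

theorem exists_potential_of_orthogonal_wirtingerDbar {v : Fin 2 → ℂ → ℂ} (hW : IsOpen W)
    (hv : ∀ i, ContDiffOn ℝ ∞ (v i) W) (hv0 : ∀ z ∈ W, (v · z) ≠ 0)
    (horth : ∀ z ∈ W, ∑ i, conj (v i z) * wirtingerDbar (v i) z = 0) :
    ∃ q : ℂ → ℂ, ContDiffOn ℝ ∞ q W ∧ ∀ z ∈ W,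
      wirtingerDbar (v 0) z = -q z * conj (v 1 z) ∧ wirtingerDbar (v 1) z = q z * conj (v 0 z) := by
  have hvv (z : ℂ) (hz : z ∈ W) := sum_conj_mul_self_ne_zero (hv0 z hz)
  have hdbar (i : Fin 2) := contDiffOn_wirtingerDbar (m := ∞) (hv i) hW (by simp)
  refine ⟨fun z => (v 0 z * wirtingerDbar (v 1) z - v 1 z * wirtingerDbar (v 0) z) *
      (∑ i, conj (v i z) * v i z)⁻¹,
    (((hv 0).mul (hdbar 1)).sub ((hv 1).mul (hdbar 0))).mul
      ((ContDiffOn.sum fun i _ => (contDiffOn_conj (hv i)).mul (hv i)).inv hvv), fun z hz => ?_⟩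
  have hvvz := hvv z hz
  have horthz := horth z hz
  simp only [Fin.sum_univ_two] at hvvz horthz ⊢
  constructor
  · rw [← neg_mul, mul_right_comm, ← div_eq_mul_inv, eq_div_iff hvvz]
    linear_combination v 0 z * horthz
  · rw [mul_right_comm, ← div_eq_mul_inv, eq_div_iff hvvz]
    linear_combination v 1 z * horthz

/-- For `u' = ∂̄u` and `∂̄v = (-q conj (v 1), q conj (v 0))`, the hypotheses are the relations
between the `∂̄(uᵢ vⱼ)` which hold when these form the spinor matrix of a real vector. -/
theorem eq_of_reality_conditions {q : ℂ} {u v u' : Fin 2 → ℂ} (hv : v ≠ 0)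
    (h₁ : u' 1 * v 1 + u 1 * (q * conj (v 0)) = -conj (u' 0 * v 0 + u 0 * (-q * conj (v 1))))
    (h₀ : u' 1 * v 0 + u 1 * (-q * conj (v 1)) = conj (u' 0 * v 1 + u 0 * (q * conj (v 0)))) :
    u' 0 = -conj q * conj (u 1) ∧ u' 1 = conj q * conj (u 0) := by
  have hvv := sum_conj_mul_self_ne_zero hv
  rw [Fin.sum_univ_two] at hvv
  simp only [map_add, map_mul, map_neg, Complex.conj_conj] at h₁ h₀
  have h0 : conj (u' 0 + conj q * conj (u 1)) = 0 := by
    refine (mul_eq_zero.1 ?_).resolve_right hvv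
    simp only [map_add, map_mul, Complex.conj_conj]
    linear_combination v 0 * h₁ - v 1 * h₀
  have h1 : u' 1 - conj q * conj (u 0) = 0 := by
    refine (mul_eq_zero.1 ?_).resolve_right hvv
    linear_combination conj (v 1) * h₁ + conj (v 0) * h₀
  rw [map_eq_zero] at h0
  exact ⟨by linear_combination h0, by linear_combination h1⟩

theorem exists_spinor_frame {M : ℂ → Matrix (Fin 2) (Fin 2) ℂ} (hW : IsOpen W)
    (hM : ∀ i j, ContDiffOn ℝ ∞ (fun z => M z i j) W) (hdet : ∀ z ∈ W, (M z).det = 0)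
    (hM0 : ∀ z ∈ W, M z ≠ 0) :
    ∃ (u v : Fin 2 → ℂ → ℂ) (q : ℂ → ℂ), (∀ i, ContDiffOn ℝ ∞ (u i) W) ∧
      (∀ i, ContDiffOn ℝ ∞ (v i) W) ∧ ContDiffOn ℝ ∞ q W ∧
      (∀ z ∈ W, M z = Matrix.vecMulVec (u · z) (v · z)) ∧
      ∀ z ∈ W, wirtingerDbar (v 0) z = -q z * conj (v 1 z) ∧
        wirtingerDbar (v 1) z = q z * conj (v 0 z) := by
  obtain ⟨u, v, hu, hv, hMuv⟩ := exists_smooth_rank_one_factorization hW hM hdet hM0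
  have hv0 (z : ℂ) (hz : z ∈ W) : (v · z) ≠ 0 := fun h =>
    hM0 z hz (by rw [hMuv z hz, h, Matrix.vecMulVec_zero])
  obtain ⟨h, hh, horth⟩ := exists_cexp_mul_orthogonal_wirtingerDbar hW hv hv0
  have hev (i : Fin 2) : ContDiffOn ℝ ∞ (fun z => Complex.exp (h z) * v i z) W := hh.cexp.mul (hv i)
  obtain ⟨q, hq, hdv⟩ := exists_potential_of_orthogonal_wirtingerDbar hW hev (fun z hz =>
    smul_ne_zero (Complex.exp_ne_zero (h z)) (hv0 z hz)) horth
  refine ⟨fun i z => Complex.exp (-h z) * u i z, fun i z => Complex.exp (h z) * v i z, q,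
    fun i => hh.neg.cexp.mul (hu i), hev, hq, fun z hz => ?_, hdv⟩
  ext i j
  rw [hMuv z hz, Matrix.vecMulVec_apply, Matrix.vecMulVec_apply, mul_mul_mul_comm,
    ← Complex.exp_add, neg_add_cancel, Complex.exp_zero, one_mul]

theorem wirtingerDbar_of_eq_vecMulVec {m n : Type*} {M : ℂ → Matrix m n ℂ} {u : m → ℂ → ℂ}
    {v : n → ℂ → ℂ} (hW : IsOpen W) (hz : z ∈ W) (hu : ∀ i, ContDiffOn ℝ ∞ (u i) W)
    (hv : ∀ j, ContDiffOn ℝ ∞ (v j) W) (hM : ∀ z ∈ W, M z = Matrix.vecMulVec (u · z) (v · z))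
    (i : m) (j : n) : wirtingerDbar (fun w => M w i j) z =
      wirtingerDbar (u i) z * v j z + u i z * wirtingerDbar (v j) z := by
  rw [← wirtingerDbar_mul (differentiableAt_of_contDiffOn (hu i) hW hz)
    (differentiableAt_of_contDiffOn (hv j) hW hz)]
  refine wirtingerDbar_congr ?_
  filter_upwards [hW.mem_nhds hz] with w hw
  rw [hM w hw, Matrix.vecMulVec_apply]

end Frame

section Existence

variable {r : ℂ → EuclideanSpace ℝ (Fin 4)} {W : Set ℂ} {z : ℂ}

/-- The vector `(∂x¹, …, ∂x⁴)` of derivatives of the coordinates of a surface `r`. -/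
noncomputable def coordWirtingerD (r : ℂ → EuclideanSpace ℝ (Fin 4)) (z : ℂ) : Fin 4 → ℂ :=
  fun k => wirtingerD (fun w => ((r w k : ℝ) : ℂ)) z

theorem forall_ofReal_fderiv_eq_form_iff {R : WeierstrassData} {k : Fin 4}
    (hr : DifferentiableAt ℝ (fun w => r w k) z) :
    (∀ v, ((fderiv ℝ (fun w => r w k) z v : ℝ) : ℂ) = R.form k z v) ↔
      R.coeff z k = coordWirtingerD r z k := by
  simp only [ofReal_fderiv_apply_eq_wirtinger hr, WeierstrassData.form]
  refine ⟨fun h => ?_, fun h v => by rw [h, coordWirtingerD]⟩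
  have h1 := h 1
  have hI := h Complex.I
  simp only [map_one, Complex.conj_I] at h1 hI
  rw [coordWirtingerD]
  linear_combination Complex.I / 2 * hI - h1 / 2 -
    (wirtingerD (fun w => ((r w k : ℝ) : ℂ)) z - conj (wirtingerD (fun w => ((r w k : ℝ) : ℂ)) z) -
      R.coeff z k + conj (R.coeff z k)) / 2 * Complex.I_sq

theorem WeierstrassData.represents_iff {R : WeierstrassData} (hW : IsOpen W)
    (hr : ContDiffOn ℝ ∞ r W) : R.Represents r W ↔
      R.SmoothOn W ∧ R.Dirac W ∧ R.DualDirac W ∧ ∀ z ∈ W, R.coeff z = coordWirtingerD r z := by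
  have hform (z : ℂ) (hz : z ∈ W) (k : Fin 4) := forall_ofReal_fderiv_eq_form_iff (R := R)
    (differentiableAt_of_contDiffOn ((contDiffOn_piLp 2).1 hr k) hW hz)
  exact ⟨fun h => ⟨h.smoothOn, h.dirac, h.dualDirac, fun z hz =>
      funext fun k => (hform z hz k).1 (h.differential z hz k)⟩,
    fun ⟨hs, hd, hd', hc⟩ => ⟨hs, hd, hd', fun z hz k => (hform z hz k).2 (congrFun (hc z hz) k)⟩⟩

theorem contDiffOn_coordWirtingerD (hr : ContDiffOn ℝ ∞ r W) (hW : IsOpen W) (k : Fin 4) :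
    ContDiffOn ℝ ∞ (fun z => coordWirtingerD r z k) W :=
  contDiffOn_wirtingerD (contDiffOn_ofReal ((contDiffOn_piLp 2).1 hr k)) hW (by simp)

theorem conj_wirtingerDbar_coordWirtingerD (hr : ContDiffAt ℝ 2 r z) (k : Fin 4) :
    conj (wirtingerDbar (fun w => coordWirtingerD r w k) z) =
      wirtingerDbar (fun w => coordWirtingerD r w k) z :=
  conj_wirtingerDbar_wirtingerD_ofReal ((contDiffAt_piLp 2).1 hr k)

namespace IsConformalImmersionOn

theorem coordWirtingerD_ne_zero (hr : IsConformalImmersionOn r W) (hW : IsOpen W) (hz : z ∈ W) :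
    coordWirtingerD r z ≠ 0 := by
  intro h
  have hdr := differentiableAt_of_contDiffOn hr.smooth hW hz
  have hcoord (k : Fin 4) : fderiv ℝ (fun w => r w k) z 1 = fderiv ℝ r z 1 k :=
    DFunLike.congr_fun
      ((EuclideanSpace.proj (𝕜 := ℝ) k).hasFDerivAt.comp z hdr.hasFDerivAt).fderiv 1
  have hfd : fderiv ℝ r z 1 = fderiv ℝ r z 0 := by
    ext k
    have hk := ofReal_fderiv_apply_eq_wirtinger
      (differentiableAt_of_contDiffOn ((contDiffOn_piLp 2).1 hr.smooth k) hW hz) 1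
    have hk0 : wirtingerD (fun w => ((r w k : ℝ) : ℂ)) z = 0 := congrFun h k
    rw [hk0, map_zero, zero_mul, zero_mul, add_zero, Complex.ofReal_eq_zero, hcoord] at hk
    rw [hk, map_zero, PiLp.zero_apply]
  exact one_ne_zero (hr.immersion z hz hfd)

theorem spinorMatrix_coordWirtingerD_ne_zero (hr : IsConformalImmersionOn r W) (hW : IsOpen W)
    (hz : z ∈ W) : spinorMatrix (coordWirtingerD r z) ≠ 0 := fun h =>
  hr.coordWirtingerD_ne_zero hW hz (spinorMatrix_injective (h.trans spinorMatrix_zero.symm))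

theorem exists_represents (hr : IsConformalImmersionOn r W) (hW : IsOpen W) :
    ∃ R : WeierstrassData, R.Represents r W := by
  have hf := contDiffOn_coordWirtingerD hr.smooth hW
  obtain ⟨u, v, q, hu, hv, hq, hM, hdv⟩ := exists_spinor_frame hW (contDiffOn_spinorMatrix hf)
    (fun z hz => (det_spinorMatrix _).trans (neg_eq_zero.2 (hr.conformal z hz))) fun z hz =>
      hr.spinorMatrix_coordWirtingerD_ne_zero hW hz
  have hdu (z : ℂ) (hz : z ∈ W) : wirtingerDbar (u 0) z = -conj (q z) * conj (u 1 z) ∧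
      wirtingerDbar (u 1) z = conj (q z) * conj (u 0 z) := by
    have hv0 : (v · z) ≠ 0 := fun h => hr.spinorMatrix_coordWirtingerD_ne_zero hW hz
      (by rw [hM z hz, h, Matrix.vecMulVec_zero])
    have hdM (i j : Fin 2) := (wirtingerDbar_spinorMatrix (fun k =>
      differentiableAt_of_contDiffOn (hf k) hW hz) i j).symm.trans
        (wirtingerDbar_of_eq_vecMulVec hW hz hu hv hM i j)
    have hreal := spinorMatrix_of_conj_eq_self (conj_wirtingerDbar_coordWirtingerD
      ((hr.smooth.contDiffAt (hW.mem_nhds hz)).of_le ENat.LEInfty.out))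
    simp only [hdM, hdv z hz] at hreal
    exact eq_of_reality_conditions (u := (u · z)) (u' := fun i => wirtingerDbar (u i) z) hv0
      hreal.1 hreal.2
  refine ⟨⟨v 1, fun z => conj (v 0 z), u 1, fun z => conj (u 0 z), fun z => conj (q z)⟩,
    (WeierstrassData.represents_iff hW hr.smooth).2 ⟨⟨hv 1, contDiffOn_conj (hv 0), hu 1,
      contDiffOn_conj (hu 0), contDiffOn_conj hq⟩, fun z hz => ?_, fun z hz => ?_,
      fun z hz => spinorMatrix_injective ?_⟩⟩
  · simp [wirtingerD_conj, hdv z hz]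
  · simp [wirtingerD_conj, hdu z hz]
  · rw [WeierstrassData.spinorMatrix_coeff, hM z hz]
    ext i j
    fin_cases i <;> fin_cases j <;> simp [Matrix.vecMulVec_apply]

end IsConformalImmersionOn

end Existence

/-! ### Gauge transformations -/

section Gauge

variable {r : ℂ → EuclideanSpace ℝ (Fin 4)} {V W : Set ℂ} {g h : ℂ → ℂ} {z : ℂ}

theorem wirtingerDbar_mul_of_differentiableAt {f : ℂ → ℂ} (hg : DifferentiableAt ℂ g z)
    (hf : DifferentiableAt ℝ f z) :
    wirtingerDbar (fun w => g w * f w) z = g z * wirtingerDbar f z := by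
  rw [wirtingerDbar_mul (hg.restrictScalars ℝ) hf, wirtingerDbar_eq_zero hg, zero_mul, zero_add]

theorem wirtingerD_conj_mul_of_differentiableAt {f : ℂ → ℂ} (hg : DifferentiableAt ℂ g z)
    (hf : DifferentiableAt ℝ f z) :
    wirtingerD (fun w => conj (g w) * f w) z = conj (g z) * wirtingerD f z := by
  have hconj : DifferentiableAt ℝ (fun w => conj (g w)) z :=
    Complex.conjCLE.differentiableAt.comp z (hg.restrictScalars ℝ)
  rw [wirtingerD_mul hconj hf, wirtingerD_conj, wirtingerDbar_eq_zero hg, map_zero, zero_mul,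
    zero_add]

theorem dirac_gauge {ψ₁ ψ₂ : ℂ → ℂ} {u : ℂ} (hh : DifferentiableAt ℂ h z)
    (hψ₁ : DifferentiableAt ℝ ψ₁ z) (hψ₂ : DifferentiableAt ℝ ψ₂ z)
    (hdirac : wirtingerD ψ₂ z + u * ψ₁ z = 0 ∧ -wirtingerDbar ψ₁ z + conj u * ψ₂ z = 0) :
    wirtingerD (fun w => Complex.exp (conj (h w)) * ψ₂ w) z +
        Complex.exp (conj (h z) - h z) * u * (Complex.exp (h z) * ψ₁ z) = 0 ∧
      -wirtingerDbar (fun w => Complex.exp (h w) * ψ₁ w) z +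
        conj (Complex.exp (conj (h z) - h z) * u) * (Complex.exp (conj (h z)) * ψ₂ z) = 0 := by
  rw [wirtingerDbar_mul_of_differentiableAt hh.cexp hψ₁]
  simp only [Complex.exp_conj, Complex.exp_sub, map_mul, map_div₀, Complex.conj_conj]
  rw [wirtingerD_conj_mul_of_differentiableAt hh.cexp hψ₂]
  have hexp := Complex.exp_ne_zero (h z)
  have hexp' : conj (Complex.exp (h z)) ≠ 0 := (map_ne_zero _).2 hexp
  field_simp
  exact ⟨by linear_combination conj (Complex.exp (h z)) * hdirac.1,
    by linear_combination Complex.exp (h z) * hdirac.2⟩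

namespace WeierstrassData

variable {R : WeierstrassData}

theorem coeff_gauge (h : ℂ → ℂ) (R : WeierstrassData) (z : ℂ) :
    (R.gauge h).coeff z = R.coeff z := by
  apply spinorMatrix_injective
  rw [spinorMatrix_coeff, spinorMatrix_coeff]
  have hexp := Complex.exp_ne_zero (h z)
  ext i j
  fin_cases i <;> fin_cases j <;>
    simp [gauge, Matrix.vecMulVec_apply, ← Complex.exp_conj, Complex.exp_neg] <;> field_simp

theorem Represents.mono (hR : R.Represents r W) (hVW : V ⊆ W) : R.Represents r V where
  smoothOn := ⟨hR.smoothOn.ψ₁.mono hVW, hR.smoothOn.ψ₂.mono hVW, hR.smoothOn.φ₁.mono hVW,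
    hR.smoothOn.φ₂.mono hVW, hR.smoothOn.U.mono hVW⟩
  dirac z hz := hR.dirac z (hVW hz)
  dualDirac z hz := hR.dualDirac z (hVW hz)
  differential z hz := hR.differential z (hVW hz)

theorem SmoothOn.gauge (hR : R.SmoothOn W) (hh : ContDiffOn ℝ ∞ h W) :
    (R.gauge h).SmoothOn W where
  ψ₁ := hh.cexp.mul hR.ψ₁
  ψ₂ := (contDiffOn_conj hh).cexp.mul hR.ψ₂
  φ₁ := hh.neg.cexp.mul hR.φ₁
  φ₂ := (contDiffOn_conj hh).neg.cexp.mul hR.φ₂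
  U := ((contDiffOn_conj hh).sub hh).cexp.mul hR.U

theorem Represents.gauge (hR : R.Represents r W) (hW : IsOpen W) (hh : DifferentiableOn ℂ h W) :
    (R.gauge h).Represents r W where
  smoothOn := hR.smoothOn.gauge ((hh.contDiffOn hW).restrict_scalars ℝ)
  dirac z hz := dirac_gauge (hh.differentiableAt (hW.mem_nhds hz))
    (differentiableAt_of_contDiffOn hR.smoothOn.ψ₁ hW hz)
    (differentiableAt_of_contDiffOn hR.smoothOn.ψ₂ hW hz) (hR.dirac z hz)
  dualDirac z hz := by
    -- The dual equation is the Dirac equation for `φ` with potential `Ū`, transformed by `-h`.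
    have hdual := dirac_gauge (h := fun w => -h w) (u := conj (R.U z))
      (hh.differentiableAt (hW.mem_nhds hz)).neg
      (differentiableAt_of_contDiffOn hR.smoothOn.φ₁ hW hz)
      (differentiableAt_of_contDiffOn hR.smoothOn.φ₂ hW hz)
      (by simpa only [Complex.conj_conj] using hR.dualDirac z hz)
    have hU : Complex.exp (conj (-h z) - -h z) * conj (R.U z) = conj ((R.gauge h).U z) := by
      simp [WeierstrassData.gauge, ← Complex.exp_conj, add_comm, sub_eq_add_neg]
    rw [hU, Complex.conj_conj] at hdual
    simp only [map_neg] at hdual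
    exact hdual
  differential z hz k v := by
    rw [hR.differential z hz, form, form, coeff_gauge]

theorem Represents.spinors_ne_zero (hR : R.Represents r W) (hr : IsConformalImmersionOn r W)
    (hW : IsOpen W) (hz : z ∈ W) :
    (R.ψ₁ z ≠ 0 ∨ R.ψ₂ z ≠ 0) ∧ (R.φ₁ z ≠ 0 ∨ R.φ₂ z ≠ 0) := by
  have hne := hr.spinorMatrix_coordWirtingerD_ne_zero hW hz
  rw [← ((represents_iff hW hr.smooth).1 hR).2.2.2 z hz, spinorMatrix_coeff] at hne
  rw [Ne, Matrix.vecMulVec_eq_zero, not_or] at hne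
  simpa [-not_and, not_and_or, or_comm, and_comm] using hne

theorem exists_contDiffOn_eqOn_cexp {a₁ a₂ b₁ b₂ : ℂ → ℂ} (ha₁ : ContDiffOn ℝ ∞ a₁ W)
    (ha₂ : ContDiffOn ℝ ∞ a₂ W) (hb₁ : ContDiffOn ℝ ∞ b₁ W) (hb₂ : ContDiffOn ℝ ∞ b₂ W)
    (ha : ∀ z ∈ W, a₁ z ≠ 0 ∨ a₂ z ≠ 0) (hVW : V ⊆ W)
    (h₁ : Set.EqOn b₁ (fun z => Complex.exp (h z) * a₁ z) V)
    (h₂ : Set.EqOn b₂ (fun z => Complex.exp (conj (h z)) * a₂ z) V) :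
    ∃ g, ContDiffOn ℝ ∞ g W ∧ Set.EqOn g (fun z => Complex.exp (h z)) V := by
  have hne (z : ℂ) (hz : z ∈ W) : conj (a₁ z) * a₁ z + conj (a₂ z) * a₂ z ≠ 0 := by
    have hv : ![a₁ z, a₂ z] ≠ 0 := fun h0 =>
      (ha z hz).elim (· (congrFun h0 0)) (· (congrFun h0 1))
    simpa using sum_conj_mul_self_ne_zero hv
  refine ⟨fun z => (b₁ z * conj (a₁ z) + conj (b₂ z) * a₂ z) *
      (conj (a₁ z) * a₁ z + conj (a₂ z) * a₂ z)⁻¹,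
    ((hb₁.mul (contDiffOn_conj ha₁)).add ((contDiffOn_conj hb₂).mul ha₂)).mul
      ((((contDiffOn_conj ha₁).mul ha₁).add ((contDiffOn_conj ha₂).mul ha₂)).inv hne),
    fun z hz => ?_⟩
  simp only [h₁ hz, h₂ hz, map_mul, ← Complex.exp_conj, Complex.conj_conj]
  rw [mul_inv_eq_iff_eq_mul₀ (hne z (hVW hz))]
  ring

theorem Represents.exists_contDiffOn_eqOn_cexp_of_extendsTo (hR : R.Represents r W)
    (hr : IsConformalImmersionOn r W) (hW : IsOpen W) (hVW : V ⊆ W)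
    (hext : (R.gauge h).ExtendsTo r V W) :
    (∃ g, ContDiffOn ℝ ∞ g W ∧ Set.EqOn g (fun z => Complex.exp (h z)) V) ∧
      ∃ g, ContDiffOn ℝ ∞ g W ∧ Set.EqOn g (fun z => Complex.exp (-h z)) V := by
  obtain ⟨S, hS, hSR⟩ := hext
  have hne (z : ℂ) (hz : z ∈ W) := hR.spinors_ne_zero hr hW hz
  exact ⟨exists_contDiffOn_eqOn_cexp hR.smoothOn.ψ₁ hR.smoothOn.ψ₂ hS.smoothOn.ψ₁ hS.smoothOn.ψ₂
      (fun z hz => (hne z hz).1) hVW hSR.ψ₁ hSR.ψ₂,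
    exists_contDiffOn_eqOn_cexp (h := fun z => -h z) hR.smoothOn.φ₁ hR.smoothOn.φ₂
      hS.smoothOn.φ₁ hS.smoothOn.φ₂ (fun z hz => (hne z hz).2) hVW hSR.φ₁
      (by simp only [map_neg]; exact hSR.φ₂)⟩

end WeierstrassData

end Gauge

section Continuation

variable {r : ℂ → EuclideanSpace ℝ (Fin 4)} {V W : Set ℂ} {p : ℂ}

theorem eq_of_eqOn_of_mem_closure {X Y : Type*} [TopologicalSpace X] [TopologicalSpace Y]
    [T2Space Y] {s : Set X} {x : X} {f g : X → Y} (hf : ContinuousAt f x) (hg : ContinuousAt g x)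
    (hx : x ∈ closure s) (h : Set.EqOn f g s) : f x = g x :=
  tendsto_nhds_unique_of_frequently_eq hf hg
    ((mem_closure_iff_frequently.1 hx).mono fun _ hy => h hy)

/-- On `V` one has `(z - p)² g' = -g`, and the left-hand side tends to zero at `p`. -/
theorem eq_zero_of_eqOn_cexp_inv {g : ℂ → ℂ} (hW : IsOpen W) (hpW : p ∈ W)
    (hg : ContDiffOn ℝ 1 g W) (hV : IsOpen V) (hp : p ∈ closure V) (hpV : p ∉ V)
    (hgV : Set.EqOn g (fun z => Complex.exp (z - p)⁻¹) V) : g p = 0 := by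
  have hfd : ContinuousAt (fun z => fderiv ℝ g z 1) p :=
    ((hg.continuousOn_fderiv_of_isOpen hW le_rfl).continuousAt (hW.mem_nhds hpW)).clm_apply
      continuousAt_const
  have hlim := eq_of_eqOn_of_mem_closure (f := fun z => (z - p) ^ 2 * fderiv ℝ g z 1)
    (g := fun z => -g z) (by fun_prop) (hg.continuousOn.continuousAt (hW.mem_nhds hpW)).neg hp
    fun z hz => ?_
  · simpa using hlim.symm
  have hzp : z - p ≠ 0 := sub_ne_zero.2 fun h => hpV (h ▸ hz)
  have hderiv := (((hasDerivAt_id z).sub_const p).fun_inv hzp).cexp.hasFDerivAt.restrictScalars ℝ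
  have heq : g =ᶠ[nhds z] fun w => Complex.exp (id w - p)⁻¹ := by
    filter_upwards [hV.mem_nhds hz] with w hw using hgV hw
  beta_reduce
  rw [heq.fderiv_eq, hderiv.fderiv, hgV hz]
  simp only [id_eq, ContinuousLinearMap.coe_restrictScalars',
    ContinuousLinearMap.toSpanSingleton_apply, smul_eq_mul, one_mul]
  field_simp

theorem not_continuesAnalyticallyTo_inv_sub (hW : IsOpen W) (hpW : p ∈ W) (hp : p ∈ closure V)
    (hpV : p ∉ V) : ¬ ContinuesAnalyticallyTo (fun z => (z - p)⁻¹) V W := by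
  rintro ⟨H, hH, hHV⟩
  have hHp : ContinuousAt H p := (hH.differentiableAt (hW.mem_nhds hpW)).continuousAt
  have hlim := eq_of_eqOn_of_mem_closure (f := fun z => H z * (z - p)) (g := fun _ => 1)
    (by fun_prop) continuousAt_const hp fun z hz => by
      simp only [hHV hz, inv_mul_cancel₀ (sub_ne_zero.2 fun h : z = p => hpV (h ▸ hz))]
  simp at hlim

theorem WeierstrassData.Represents.not_extendsTo_gauge_inv_sub {R : WeierstrassData}
    (hR : R.Represents r W) (hr : IsConformalImmersionOn r W) (hW : IsOpen W) (hpW : p ∈ W)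
    (hV : IsOpen V) (hVW : V ⊆ W) (hp : p ∈ closure V) (hpV : p ∉ V) :
    ¬ (R.gauge fun z => (z - p)⁻¹).ExtendsTo r V W := by
  intro hext
  obtain ⟨⟨g, hg, hgV⟩, g', hg', hgV'⟩ :=
    hR.exists_contDiffOn_eqOn_cexp_of_extendsTo hr hW hVW hext
  have hmul : g p * g' p = 1 := eq_of_eqOn_of_mem_closure
    (f := fun z => g z * g' z) (g := fun _ => 1)
    ((hg.continuousOn.mul hg'.continuousOn).continuousAt (hW.mem_nhds hpW))
    continuousAt_const hp fun z hz => by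
      simp only [hgV hz, hgV' hz, ← Complex.exp_add, add_neg_cancel, Complex.exp_zero]
  rw [eq_zero_of_eqOn_cexp_inv hW hpW (hg.of_le (by simp)) hV hp hpV hgV, zero_mul] at hmul
  exact zero_ne_one hmul

theorem connectedComponentIn_eq_of_inter_closure_subset {X : Type*} [TopologicalSpace X]
    {V W : Set X} {x : X} (hV : IsOpen V) (hVconn : IsPreconnected V) (hVW : V ⊆ W)
    (hcl : W ∩ closure V ⊆ V) (hx : x ∈ V) : connectedComponentIn W x = V := by
  refine Set.Subset.antisymm ?_ (hVconn.subset_connectedComponentIn hx hVW)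
  refine isPreconnected_connectedComponentIn.subset_left_of_subset_union hV
    isClosed_closure.isOpen_compl (disjoint_compl_right.mono_left subset_closure) (fun y hy => ?_)
    ⟨x, mem_connectedComponentIn (hVW hx), hx⟩
  exact (Classical.em (y ∈ closure V)).imp_left fun hyV =>
    hcl ⟨connectedComponentIn_subset _ _ hy, hyV⟩

end Continuation

theorem mainTheorem3_general (W V : Set ℂ) (hW : IsOpen W)
    (r : ℂ → EuclideanSpace ℝ (Fin 4)) (hr : IsConformalImmersionOn r W)
    (hV : IsOpen V) (hVW : V ⊆ W) (hcl : ¬ W ∩ closure V ⊆ V) :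
    (∃ R : WeierstrassData, R.Represents r W) ∧
    ∃ h : ℂ → ℂ, DifferentiableOn ℂ h V ∧ ¬ ContinuesAnalyticallyTo h V W ∧
      ∀ R : WeierstrassData, R.Represents r W →
        (R.gauge h).Represents r V ∧ ¬ (R.gauge h).ExtendsTo r V W := by
  obtain ⟨p, ⟨hpW, hp⟩, hpV⟩ := Set.not_subset.1 hcl
  have hh : DifferentiableOn ℂ (fun z => (z - p)⁻¹) V :=
    DifferentiableOn.inv (by fun_prop) fun z hz => sub_ne_zero.2 fun h => hpV (h ▸ hz)
  exact ⟨hr.exists_represents hW, fun z => (z - p)⁻¹, hh,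
    not_continuesAnalyticallyTo_inv_sub hW hpW hp hpV, fun R hR =>
      ⟨(hR.mono hVW).gauge hV hh, hR.not_extendsTo_gauge_inv_sub hr hW hpW hV hVW hp hpV⟩⟩

theorem mainTheorem3 (W V : Set ℂ) (hW : IsOpen W)
    (r : ℂ → EuclideanSpace ℝ (Fin 4)) (hr : IsConformalImmersionOn r W)
    (hV : IsOpen V) (hVconn : IsConnected V) (hVW : V ⊂ W)
    (hcomp : ∀ z ∈ V, connectedComponentIn W z ≠ V) :
    (∃ R : WeierstrassData, R.Represents r W) ∧
    ∃ h : ℂ → ℂ, DifferentiableOn ℂ h V ∧ ¬ ContinuesAnalyticallyTo h V W ∧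
      ∀ R : WeierstrassData, R.Represents r W →
        (R.gauge h).Represents r V ∧ ¬ (R.gauge h).ExtendsTo r V W :=
  mainTheorem3_general W V hW r hr hV hVW.subset fun hcl => hVconn.nonempty.elim fun z hz =>
    hcomp z hz (connectedComponentIn_eq_of_inter_closure_subset hV hVconn.isPreconnected
      hVW.subset hcl hz)
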